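/- Let $\mathcal T_H$ be a rectangular coarse grid in the plane: finitely many of the cells $[x_i,x_{i+1}]\times[y_j,y_{j+1}]$ cut out by two families of grid lines. The dual grid is formed by the horizontal and vertical center lines of the cells. An interface $E=E_{ij}$ is one of the two halves into which a dual center line cuts the common edge of two neighbouring cells $i,j$ of $\mathcal T_H$; its unit normal $n_E$ points from left to right or from bottom to top. The local domain $\Omega_{ij}$ is the open rectangle consisting of the two quarters of the cells $i$ and $j$ that meet in $E_{ij}$ (a half of a dual cell in the interior of the grid). For a vertical interface, denote by $e^l_{ij},e^r_{ij}$ (parallel to $E_{ij}$) and $e^b_{ij},e^t_{ij}$ the left, right, bottom and top sides of $\Omega_{ij}$, and by $n$ its outward unit normal. Let $k$ be a scalar or matrix-valued coefficient, and let $v$ be a vector field with $\int_{e^l_{ij}}v\cdot n\ne0$ and $\int_{e^r_{ij}}v\cdot n\neq 0$. Let $\phi_{ij}\in H^1(\Omega_{ij})$, with $k\nabla\phi_{ij}\in L^2(\Omega_{ij})^2$, be a weak solution of $$-\operatorname{div}(k\nabla\phi_{ij})=0\ \text{ in }\Omega_{ij},\qquad -k\nabla\phi_{ij}\cdot n=\begin{cases}-\dfrac{v\cdot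 n}{\int_{e^l_{ij}}v\cdot n}&\text{on }e^l_{ij},\\[2mm] \dfrac{v\cdot n}{\int_{e^r_{ij}}v\cdot n}&\text{on }e^r_{ij},\\[2mm] 0&\text{on }e^b_{ij}\cup e^t_{ij}.\end{cases}$$ For a horizontal interface the same is required with bottom/top in place of left/right and left/right in place of bottom/top. Let $\psi_{ij}=-k\nabla\phi_{ij}$ in $\Omega_{ij}$ and $\psi_{ij}=0$ outside $\Omega_{ij}$. Then, for every interface $E_{ij}$, the function $\psi_{ij}$ has unit flux, $$\int_{E_{ij}}\psi_{ij}\cdot n_{E_{ij}}=1,$$ where the flux is the common limit, as $\varepsilon\to0^+$, of $\varepsilon^{-1}\int\psi_{ij}\cdot n_{E_{ij}}$ over the strips of width $\varepsilon$ on either side of $E_{ij}$; and the equality also holds for the ordinary integral whenever $\psi_{ij}\cdot n_{E_{ij}}$ agrees almost everywhere in $\Omega_{ij}$ with a function that is continuous at the points of the relatively open segment $E_{ij}$ and integrable on $E_{ij}$. Moreover, all the functions $\psi_{ij}$ belong to $L^2(\mathbb R^2)^2$ and are linearly independent there, so that they form a basis of the velocity space $\mathcal U_H=\operatorname{span}\{\psi_{ij}\}$.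 -/

import Mathlib

open MeasureTheory Filter Topology
open scoped ContDiff

noncomputable section

namespace MsFV

/-! ### Rectangles in the plane, their sides, and boundary integrals -/

/-- The Euclidean scalar product of two vectors of the plane. -/
def dot (u w : ℝ × ℝ) : ℝ := u.1 * w.1 + u.2 * w.2

/-- The gradient of a differentiable function of two real variables. -/
def grad (w : ℝ × ℝ → ℝ) (p : ℝ × ℝ) : ℝ × ℝ :=
  (fderiv ℝ w p (1, 0), fderiv ℝ w p (0, 1))

/-- An axis-parallel rectangle `(a, b) × (c, d)`. -/
structure Rect where
  a : ℝ
  b : ℝ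
  c : ℝ
  d : ℝ

/-- The open set described by a rectangle. -/
def Rect.toSet (R : Rect) : Set (ℝ × ℝ) := Set.Ioo R.a R.b ×ˢ Set.Ioo R.c R.d

/-- The four sides `e^l`, `e^r`, `e^b`, `e^t` of a rectangle. -/
inductive Side
  | left
  | right
  | bottom
  | top

/-- The unit normal vector on a side that points out of the rectangle. -/
def Side.normal : Side → ℝ × ℝ
  | .left => (-1, 0)
  | .right => (1, 0)
  | .bottom => (0, -1)
  | .top => (0, 1)

/-- The integral of `f` over a side of `R` with respect to arc length. -/
def Rect.sideIntegral (R : Rect) (s : Side) (f : ℝ × ℝ → ℝ) : ℝ :=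
  match s with
  | .left => ∫ t in R.c..R.d, f (R.a, t)
  | .right => ∫ t in R.c..R.d, f (R.b, t)
  | .bottom => ∫ t in R.a..R.b, f (t, R.c)
  | .top => ∫ t in R.a..R.b, f (t, R.d)

/-- The integral over the boundary of `R` of a function that may be given by a different formula
on each side. -/
def Rect.boundaryIntegral (R : Rect) (f : Side → ℝ × ℝ → ℝ) : ℝ :=
  R.sideIntegral .left (f .left) + R.sideIntegral .right (f .right)
    + R.sideIntegral .bottom (f .bottom) + R.sideIntegral .top (f .top)

/-! ### Sobolev functions -/

/-- `φ ∈ H¹(R)` with weak gradient `G ∈ L²(R)²`. -/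
structure IsH1With (R : Rect) (φ : ℝ × ℝ → ℝ) (G : ℝ × ℝ → ℝ × ℝ) : Prop where
  memLp : MemLp φ 2 (volume.restrict R.toSet)
  memLp_grad : MemLp G 2 (volume.restrict R.toSet)
  weak_fst : ∀ η : ℝ × ℝ → ℝ, ContDiff ℝ ∞ η → HasCompactSupport η → tsupport η ⊆ R.toSet →
    ∫ p in R.toSet, φ p * (grad η p).1 = - ∫ p in R.toSet, (G p).1 * η p
  weak_snd : ∀ η : ℝ × ℝ → ℝ, ContDiff ℝ ∞ η → HasCompactSupport η → tsupport η ⊆ R.toSet →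
    ∫ p in R.toSet, φ p * (grad η p).2 = - ∫ p in R.toSet, (G p).2 * η p

/-- `φ ∈ H¹(R)`, with weak gradient `G`, is a weak solution of the Neumann problem
`-div (k ∇φ) = 0` in `R`, `-k ∇φ · n = g` on `∂R` (`n` pointing out of `R`), where `g s` is the
datum on the side `s`. The flux `-k ∇φ` is required to be square integrable, which is automatic
for a bounded measurable `k`. Multiplying the equation by a test function `w` and
integrating by parts gives `∫_R (-k ∇φ) · ∇w = ∫_∂R g w`; the functions that are smooth on the
plane are dense in `H¹(R)`. -/
structure IsNeumannSolution (R : Rect) (k : ℝ × ℝ → (ℝ × ℝ →ₗ[ℝ] ℝ × ℝ))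
    (g : Side → ℝ × ℝ → ℝ) (φ : ℝ × ℝ → ℝ) (G : ℝ × ℝ → ℝ × ℝ) : Prop where
  isH1 : IsH1With R φ G
  memLp_flux : MemLp (fun p => -(k p (G p))) 2 (volume.restrict R.toSet)
  weak_form : ∀ w : ℝ × ℝ → ℝ, ContDiff ℝ ∞ w →
    ∫ p in R.toSet, dot (-(k p (G p))) (grad w p) = R.boundaryIntegral fun s p => g s p * w p

/-! ### Coarse grids, dual cells and interfaces -/

/-- The direction of the flux through an interface: `horizontal` for a vertical interface between
a cell and its right neighbour, `vertical` for a horizontal interface between a cell and its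
upper neighbour. -/
inductive Direction
  | horizontal
  | vertical

/-- A dual cell line cuts an edge between two primary cells into two halves: `first` is the lower
half of a vertical edge and the left half of a horizontal one, `second` is the other half. -/
inductive Half
  | first
  | second

/-- A rectangular primary grid: finitely many of the cells
`[x i, x (i + 1)] × [y j, y (j + 1)]` cut out by two families of grid lines. The domain of the
problem is the interior of the union of these cells. -/
structure CoarseGrid where
  x : ℤ → ℝ
  y : ℤ → ℝ
  x_strictMono : StrictMono x
  y_strictMono : StrictMono y
  cells : Finset (ℤ × ℤ)

/-- The first coordinate of the centers of the cells in column `i`. -/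
def CoarseGrid.xc (T : CoarseGrid) (i : ℤ) : ℝ := (T.x i + T.x (i + 1)) / 2

/-- The second coordinate of the centers of the cells in row `j`. -/
def CoarseGrid.yc (T : CoarseGrid) (j : ℤ) : ℝ := (T.y j + T.y (j + 1)) / 2

/-- The neighbour of a cell to the right, respectively above. -/
def Direction.next : Direction → ℤ × ℤ → ℤ × ℤ
  | .horizontal, c => (c.1 + 1, c.2)
  | .vertical, c => (c.1, c.2 + 1)

/-- An interface: the part, inside one dual cell, of the common edge of two neighbouring primary
cells. It is given by the left (or lower) of the two cells, the direction, and the half. The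
vertices of the dual cells are the cell centers (and, along the boundary of the domain,
the projections of these on it), so that a dual cell contains one half of each edge it meets. -/
structure CoarseGrid.Interface (T : CoarseGrid) where
  dir : Direction
  cell : ℤ × ℤ
  half : Half
  cell_mem : cell ∈ T.cells
  next_mem : dir.next cell ∈ T.cells

variable {T : CoarseGrid}

/-- The position of the interface on the axis along its normal: the interface lies on the line
`x₁ = level` or `x₂ = level`. -/
def CoarseGrid.Interface.level (E : T.Interface) : ℝ :=
  match E.dir with
  | .horizontal => T.x (E.cell.1 + 1)
  | .vertical => T.y (E.cell.2 + 1)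

/-- The lower end point of the interface, as a coordinate along the interface. -/
def CoarseGrid.Interface.lo (E : T.Interface) : ℝ :=
  match E.dir, E.half with
  | .horizontal, .first => T.y E.cell.2
  | .horizontal, .second => T.yc E.cell.2
  | .vertical, .first => T.x E.cell.1
  | .vertical, .second => T.xc E.cell.1

/-- The upper end point of the interface, as a coordinate along the interface. -/
def CoarseGrid.Interface.hi (E : T.Interface) : ℝ :=
  match E.dir, E.half with
  | .horizontal, .first => T.yc E.cell.2
  | .horizontal, .second => T.y (E.cell.2 + 1)
  | .vertical, .first => T.xc E.cell.1
  | .vertical, .second => T.x (E.cell.1 + 1)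

/-- The unit normal of the interface, directed from left to right or from bottom to top. -/
def CoarseGrid.Interface.normal (E : T.Interface) : ℝ × ℝ :=
  match E.dir with
  | .horizontal => (1, 0)
  | .vertical => (0, 1)

/-- The arc-length parametrization of the line through the interface; the interface is the image
of the interval from `E.lo` to `E.hi`. -/
def CoarseGrid.Interface.point (E : T.Interface) (t : ℝ) : ℝ × ℝ :=
  match E.dir with
  | .horizontal => (E.level, t)
  | .vertical => (t, E.level)

/-- The points whose distance from the line through the interface, measured along the normal, lies
between `r` and `s`, and whose projection on this line belongs to the interface. -/
def CoarseGrid.Interface.strip (E : T.Interface) (r s : ℝ) : Rect :=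
  match E.dir with
  | .horizontal => ⟨E.level + r, E.level + s, E.lo, E.hi⟩
  | .vertical => ⟨E.lo, E.hi, E.level + r, E.level + s⟩

/-- The local domain `Ω_E` of the interface: the rectangle that reaches, across the interface, from
the center line of one adjacent cell to the center line of the other one; it is the part of
the dual cell that is made of the quarters of the two adjacent cells. -/
def CoarseGrid.Interface.domain (E : T.Interface) : Rect :=
  match E.dir with
  | .horizontal => ⟨T.xc E.cell.1, T.xc (E.cell.1 + 1), E.lo, E.hi⟩
  | .vertical => ⟨E.lo, E.hi, T.yc E.cell.2, T.yc (E.cell.2 + 1)⟩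

/-! ### The local problem and the velocity basis functions -/

/-- The side through which the flux enters the local domain. -/
def Direction.inflow : Direction → Side
  | .horizontal => .left
  | .vertical => .bottom

/-- The side through which the flux leaves the local domain. -/
def Direction.outflow : Direction → Side
  | .horizontal => .right
  | .vertical => .top

/-- The total flux of `v` out of the rectangle `R` through one of its sides. -/
def Rect.sideFlux (R : Rect) (v : ℝ × ℝ → ℝ × ℝ) (s : Side) : ℝ :=
  R.sideIntegral s fun p => dot (v p) s.normal

/-- The Neumann datum built from the vector field `v`: `-(v · n) / ∫ v · n` on the inflow side,
`(v · n) / ∫ v · n` on the outflow side (each integral over the same side), and `0` on the two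
other sides, where `n` points out of `R`. -/
def boundaryFlux (R : Rect) (v : ℝ × ℝ → ℝ × ℝ) : Direction → Side → ℝ × ℝ → ℝ
  | .horizontal, .left, p => -(dot (v p) Side.left.normal / R.sideFlux v .left)
  | .horizontal, .right, p => dot (v p) Side.right.normal / R.sideFlux v .right
  | .horizontal, .bottom, _ => 0
  | .horizontal, .top, _ => 0
  | .vertical, .bottom, p => -(dot (v p) Side.bottom.normal / R.sideFlux v .bottom)
  | .vertical, .top, p => dot (v p) Side.top.normal / R.sideFlux v .top
  | .vertical, .left, _ => 0
  | .vertical, .right, _ => 0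

/-- `φ`, with weak gradient `G`, solves the local basis problem of the interface `E`. -/
def IsBasisSolution (k : ℝ × ℝ → (ℝ × ℝ →ₗ[ℝ] ℝ × ℝ)) (v : ℝ × ℝ → ℝ × ℝ) (E : T.Interface)
    (φ : ℝ × ℝ → ℝ) (G : ℝ × ℝ → ℝ × ℝ) : Prop :=
  IsNeumannSolution E.domain k (boundaryFlux E.domain v E.dir) φ G

/-- The velocity basis function `ψ = -k ∇φ` on the local domain of `E`, where `G` is the weak
gradient of `φ`, extended by zero to the plane. -/
def velocityBasis (k : ℝ × ℝ → (ℝ × ℝ →ₗ[ℝ] ℝ × ℝ)) (G : ℝ × ℝ → ℝ × ℝ) (E : T.Interface) :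
    ℝ × ℝ → ℝ × ℝ :=
  E.domain.toSet.indicator fun p => -(k p (G p))

/-! ### The flux through an interface -/

/-- The field `u`, which is only defined up to null sets, has the flux `F` through the interface
`E`: its mean normal fluxes over thin strips on either side of the interface converge to `F`.
By Green's formula, the integral `ε⁻¹ ∫ u · n` over such a strip is the pairing of the weak
normal trace of `u` on the interface with a function that equals `1` on the interface and
decreases linearly to `0` across the strip. Where `u · n` is continuous up to the interface,
the limit is the ordinary integral of `u · n` over the interface. -/
def HasFlux (E : T.Interface) (u : ℝ × ℝ → ℝ × ℝ) (F : ℝ) : Prop :=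
  (∀ᶠ ε in 𝓝[>] (0 : ℝ), IntegrableOn (fun p => dot (u p) E.normal) (E.strip (-ε) ε).toSet) ∧
  Tendsto (fun ε : ℝ => ε⁻¹ * ∫ p in (E.strip (-ε) 0).toSet, dot (u p) E.normal)
    (𝓝[>] 0) (𝓝 F) ∧
  Tendsto (fun ε : ℝ => ε⁻¹ * ∫ p in (E.strip 0 ε).toSet, dot (u p) E.normal)
    (𝓝[>] 0) (𝓝 F)

/-- In the local domain of `E`, the normal component of the field `u` is represented, up to a null
set, by the function `g` which is continuous at every point of the open interface and integrable over the interface. -/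
structure HasClassicalNormal (E : T.Interface) (u : ℝ × ℝ → ℝ × ℝ) (g : ℝ × ℝ → ℝ) : Prop where
  ae_eq : g =ᵐ[volume.restrict E.domain.toSet] fun p => dot (u p) E.normal
  continuousAt : ∀ t ∈ Set.Ioo E.lo E.hi, ContinuousAt g (E.point t)
  integrable : IntervalIntegrable (fun t => g (E.point t)) volume E.lo E.hi

/-- The velocity space `U_H`, spanned in `L²` by the given family of fields. -/
def velocitySpace (ψ : T.Interface → Lp (ℝ × ℝ) 2 (volume : Measure (ℝ × ℝ))) :
    Submodule ℝ (Lp (ℝ × ℝ) 2 (volume : Measure (ℝ × ℝ))) :=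
  Submodule.span ℝ (Set.range ψ)

end MsFV

end

namespace MsFV

/-! ### Smooth cutoff functions of one variable -/

/-! Rotate coordinates so that the flux direction is the first axis, and test the weak form only
with products `θ x * η y`. If `η = 1`, the normalized boundary data contribute exactly `θ b - θ a`,
whatever the distribution of `v` along the two sides. If `θ` vanishes at both ends, the boundary
term disappears for every `η`. These two facts and square integrability (`IsUnitFlow`) are all that
the rest uses.

Unit flux: since `deriv θ` can be any test function, the flux through almost every line parallel to
the interface is `1` (`IsUnitFlow.section_eq_one`). A strip of width `ε` next to the interface thus
carries exactly `ε`, on either side.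

Classical integral: knowing the flux through whole sections does not exclude that, in the limit,
part of it escapes into the end points of the interface. Square integrability forbids this. A cutoff
at scale `δ` has gradient of order `1 / δ`, and its error terms live in two boxes of area of order
`δ ^ 2`, so by Cauchy-Schwarz they are bounded by a multiple of the `L²` norm of the field on these
boxes, which tends to `0` (`tendsto_cornerFlux`). The resulting bound
`IsUnitFlow.abs_one_sub_integral_le` is uniform in the width `ε ≤ δ` of the averaging strip, so `ε`
and then `δ` may tend to `0`.

Linear independence: local domains of interfaces of different directions overlap, so disjoint
supports do not suffice. Instead, each `E` gets a functional: integrate against the gradient of `θ x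
* η y` over the half of its domain before `E`, with `η` supported inside the open range of `E`. The
only other domains meeting this half belong to perpendicular interfaces and contain it with the same
extent across `E`. There `η` vanishes on the inflow and outflow sides and `θ` is unrestricted only
along the no-flow sides, so the functional is `0` (`setIntegral_lowerPart_eq_zero`). On the function
of `E` itself it is nonzero for some `θ`, `η`, because it would otherwise miss the unit flux, up to
the same small corner error (`IsUnitFlow.exists_integral_ne_zero`). -/

theorem deriv_smoothTransition_eq_zero {x : ℝ} (hx : x < 0 ∨ 1 < x) :
    deriv Real.smoothTransition x = 0 := by
  rcases hx with hx | hx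
  · have : Real.smoothTransition =ᶠ[𝓝 x] fun _ => 0 := by
      filter_upwards [Iio_mem_nhds hx] with y hy
      exact Real.smoothTransition.zero_of_nonpos (le_of_lt hy)
    simp [this.deriv_eq]
  · have : Real.smoothTransition =ᶠ[𝓝 x] fun _ => 1 := by
      filter_upwards [Ioi_mem_nhds hx] with y hy
      exact Real.smoothTransition.one_of_one_le (le_of_lt hy)
    simp [this.deriv_eq]

theorem contDiff_smoothTransition : ContDiff ℝ ∞ Real.smoothTransition :=
  Real.smoothTransition.contDiff

theorem continuous_deriv_of_smooth {f : ℝ → ℝ} (hf : ContDiff ℝ ∞ f) : Continuous (deriv f) :=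
  hf.continuous_deriv (by simp)

theorem differentiable_of_smooth {f : ℝ → ℝ} (hf : ContDiff ℝ ∞ f) : Differentiable ℝ f :=
  hf.differentiable (by simp)

theorem exists_abs_deriv_smoothTransition_le :
    ∃ C : ℝ, 0 < C ∧ ∀ x, |deriv Real.smoothTransition x| ≤ C := by
  obtain ⟨C, hC⟩ := (isCompact_Icc (a := (0 : ℝ)) (b := 1)).exists_bound_of_continuousOn
    (continuous_deriv_of_smooth contDiff_smoothTransition).continuousOn
  refine ⟨max C 1, by positivity, fun x => ?_⟩
  by_cases hx : x ∈ Set.Icc (0 : ℝ) 1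
  · exact (hC x hx).trans (le_max_left _ _)
  · rw [deriv_smoothTransition_eq_zero, abs_zero]
    · positivity
    · by_contra! h
      exact hx ⟨h.1, h.2⟩

/-- A bound for the derivative of the smooth transition function. -/
noncomputable def slope : ℝ := exists_abs_deriv_smoothTransition_le.choose

theorem slope_pos : 0 < slope := exists_abs_deriv_smoothTransition_le.choose_spec.1

theorem abs_deriv_smoothTransition_le (x : ℝ) : |deriv Real.smoothTransition x| ≤ slope :=
  exists_abs_deriv_smoothTransition_le.choose_spec.2 x

/-- A smooth function that increases from `0` to `1` on the interval `[m - δ, m]`. -/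
noncomputable def ramp (m δ x : ℝ) : ℝ := Real.smoothTransition ((x - m) / δ + 1)

theorem contDiff_ramp (m δ : ℝ) : ContDiff ℝ ∞ (ramp m δ) :=
  contDiff_smoothTransition.comp (((contDiff_id.sub contDiff_const).div_const δ).add contDiff_const)

theorem ramp_eq_zero {m δ x : ℝ} (hδ : 0 < δ) (hx : x ≤ m - δ) : ramp m δ x = 0 := by
  refine Real.smoothTransition.zero_of_nonpos ?_
  have : (x - m) / δ ≤ -1 := by rw [div_le_iff₀ hδ]; linarith
  linarith

theorem ramp_eq_one {m δ x : ℝ} (hδ : 0 < δ) (hx : m ≤ x) : ramp m δ x = 1 := by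
  refine Real.smoothTransition.one_of_one_le ?_
  have : 0 ≤ (x - m) / δ := div_nonneg (by linarith) hδ.le
  linarith

theorem ramp_nonneg (m δ x : ℝ) : 0 ≤ ramp m δ x := Real.smoothTransition.nonneg _

theorem ramp_le_one (m δ x : ℝ) : ramp m δ x ≤ 1 := Real.smoothTransition.le_one _

theorem deriv_ramp (m δ x : ℝ) :
    deriv (ramp m δ) x = deriv Real.smoothTransition ((x - m) / δ + 1) / δ := by
  have h := ((differentiable_of_smooth contDiff_smoothTransition)
    ((x - m) / δ + 1)).hasDerivAt.comp x ((((hasDerivAt_id x).sub_const m).div_const δ).add_const 1)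
  have h' : HasDerivAt (ramp m δ) _ x := h
  rw [h'.deriv, mul_one_div]

theorem abs_deriv_ramp_le {m δ : ℝ} (hδ : 0 < δ) (x : ℝ) : |deriv (ramp m δ) x| ≤ slope / δ := by
  rw [deriv_ramp, abs_div, abs_of_pos hδ]
  have := abs_deriv_smoothTransition_le ((x - m) / δ + 1)
  gcongr

theorem deriv_ramp_eq_zero {m δ x : ℝ} (hδ : 0 < δ) (hx : x < m - δ ∨ m < x) :
    deriv (ramp m δ) x = 0 := by
  rw [deriv_ramp, deriv_smoothTransition_eq_zero, zero_div]
  rcases hx with hx | hx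
  · left
    have : (x - m) / δ < -1 := by rw [div_lt_iff₀ hδ]; linarith
    linarith
  · right
    have : 0 < (x - m) / δ := div_pos (by linarith) hδ
    linarith

theorem deriv_ramp_nonneg {m δ : ℝ} (hδ : 0 < δ) (x : ℝ) : 0 ≤ deriv (ramp m δ) x := by
  refine Monotone.deriv_nonneg (fun y z hyz => ?_)
  exact Real.smoothTransition.monotone (by gcongr)

/-- A smooth function that vanishes up to the distance `δ` from the end points of `(c, d)`, and
equals `1` from the distance `2 * δ` on. -/
noncomputable def cutoff (c d δ y : ℝ) : ℝ := ramp (c + 2 * δ) δ y * ramp (2 * δ - d) δ (-y)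

theorem contDiff_cutoff (c d δ : ℝ) : ContDiff ℝ ∞ (cutoff c d δ) :=
  (contDiff_ramp _ _).mul ((contDiff_ramp _ _).comp contDiff_neg)

theorem cutoff_nonneg (c d δ y : ℝ) : 0 ≤ cutoff c d δ y :=
  mul_nonneg (ramp_nonneg _ _ _) (ramp_nonneg _ _ _)

theorem cutoff_le_one (c d δ y : ℝ) : cutoff c d δ y ≤ 1 :=
  mul_le_one₀ (ramp_le_one _ _ _) (ramp_nonneg _ _ _) (ramp_le_one _ _ _)

theorem cutoff_eq_zero {c d δ y : ℝ} (hδ : 0 < δ) (hy : y ≤ c + δ ∨ d - δ ≤ y) :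
    cutoff c d δ y = 0 := by
  rcases hy with hy | hy
  · rw [cutoff, ramp_eq_zero hδ (by linarith), zero_mul]
  · rw [cutoff, ramp_eq_zero (x := -y) hδ (by linarith), mul_zero]

theorem cutoff_eq_one {c d δ y : ℝ} (hδ : 0 < δ) (hy : c + 2 * δ ≤ y) (hy' : y ≤ d - 2 * δ) :
    cutoff c d δ y = 1 := by
  rw [cutoff, ramp_eq_one hδ hy, ramp_eq_one hδ (by linarith), one_mul]

theorem tsupport_cutoff_subset {c d δ : ℝ} (hδ : 0 < δ) :
    tsupport (cutoff c d δ) ⊆ Set.Ioo c d := by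
  have : tsupport (cutoff c d δ) ⊆ Set.Icc (c + δ) (d - δ) := by
    refine closure_minimal (fun y hy => ?_) isClosed_Icc
    by_contra hy'
    refine hy (cutoff_eq_zero hδ ?_)
    by_contra! h
    exact hy' ⟨h.1.le, h.2.le⟩
  exact this.trans (Set.Icc_subset_Ioo (by linarith) (by linarith))

theorem deriv_cutoff (c d δ y : ℝ) : deriv (cutoff c d δ) y =
    deriv (ramp (c + 2 * δ) δ) y * ramp (2 * δ - d) δ (-y)
      - ramp (c + 2 * δ) δ y * deriv (ramp (2 * δ - d) δ) (-y) := by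
  have h₁ := (differentiable_of_smooth (contDiff_ramp (c + 2 * δ) δ) y).hasDerivAt
  have h₂ := (differentiable_of_smooth (contDiff_ramp (2 * δ - d) δ) (-y)).hasDerivAt.comp y
    (hasDerivAt_neg y)
  have h : HasDerivAt (cutoff c d δ) _ y := h₁.mul h₂
  rw [h.deriv]
  ring

theorem abs_deriv_cutoff_le {c d δ : ℝ} (hδ : 0 < δ) (y : ℝ) :
    |deriv (cutoff c d δ) y| ≤ 2 * slope / δ := by
  rw [deriv_cutoff]
  have h₁ := abs_deriv_ramp_le (m := c + 2 * δ) hδ y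
  have h₂ := abs_deriv_ramp_le (m := 2 * δ - d) hδ (-y)
  have h₃ : |deriv (ramp (c + 2 * δ) δ) y * ramp (2 * δ - d) δ (-y)| ≤ slope / δ := by
    rw [abs_mul, abs_of_nonneg (ramp_nonneg _ _ _)]
    exact (mul_le_of_le_one_right (abs_nonneg _) (ramp_le_one _ _ _)).trans h₁
  have h₄ : |ramp (c + 2 * δ) δ y * deriv (ramp (2 * δ - d) δ) (-y)| ≤ slope / δ := by
    rw [abs_mul, abs_of_nonneg (ramp_nonneg _ _ _)]
    exact (mul_le_of_le_one_left (abs_nonneg _) (ramp_le_one _ _ _)).trans h₂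
  calc _ ≤ _ := abs_sub _ _
    _ ≤ slope / δ + slope / δ := add_le_add h₃ h₄
    _ = _ := by ring

theorem deriv_cutoff_eq_zero {c d δ y : ℝ} (hδ : 0 < δ) (hy : c + 2 * δ < y)
    (hy' : y < d - 2 * δ) : deriv (cutoff c d δ) y = 0 := by
  rw [deriv_cutoff, deriv_ramp_eq_zero hδ (.inr hy), deriv_ramp_eq_zero hδ (.inr (by linarith))]
  ring

/-! ### Square integrable fields on a rectangle -/

theorem Rect.measurableSet (R : Rect) : MeasurableSet R.toSet :=
  measurableSet_Ioo.prod measurableSet_Ioo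

theorem Rect.volume_lt_top (R : Rect) : volume R.toSet < ⊤ := by
  rw [Rect.toSet, Measure.volume_eq_prod, Measure.prod_prod, Real.volume_Ioo, Real.volume_Ioo]
  exact ENNReal.mul_lt_top ENNReal.ofReal_lt_top ENNReal.ofReal_lt_top

instance (R : Rect) : IsFiniteMeasure (volume.restrict R.toSet) :=
  ⟨by simpa using R.volume_lt_top⟩

theorem Rect.exists_bound (R : Rect) {h : ℝ × ℝ → ℝ} (hh : Continuous h) :
    ∃ C, ∀ q ∈ R.toSet, ‖h q‖ ≤ C := by
  obtain ⟨C, hC⟩ := (isCompact_Icc.prod isCompact_Icc :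
    IsCompact (Set.Icc R.a R.b ×ˢ Set.Icc R.c R.d)).exists_bound_of_continuousOn hh.continuousOn
  exact ⟨C, fun q hq => hC q (Set.prod_mono Set.Ioo_subset_Icc_self Set.Ioo_subset_Icc_self hq)⟩

theorem Rect.integrable_mul (R : Rect) {f h : ℝ × ℝ → ℝ}
    (hf : IntegrableOn f R.toSet) (hh : Continuous h) :
    IntegrableOn (fun q => f q * h q) R.toSet := by
  obtain ⟨C, hC⟩ := R.exists_bound hh
  refine Integrable.mul_bdd (c := C) hf hh.aestronglyMeasurable ?_
  exact (ae_restrict_iff' R.measurableSet).2 (.of_forall hC)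

theorem integrableOn_fst {R : Rect} {u : ℝ × ℝ → ℝ × ℝ}
    (hu : MemLp u 2 (volume.restrict R.toSet)) : IntegrableOn (fun q => (u q).1) R.toSet :=
  hu.fst.integrable (by norm_num)

theorem integrableOn_snd {R : Rect} {u : ℝ × ℝ → ℝ × ℝ}
    (hu : MemLp u 2 (volume.restrict R.toSet)) : IntegrableOn (fun q => (u q).2) R.toSet :=
  hu.snd.integrable (by norm_num)

/-- The gradient of the function `θ x * η y`. -/
noncomputable def tensorGrad (θ η : ℝ → ℝ) (q : ℝ × ℝ) : ℝ × ℝ :=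
  (deriv θ q.1 * η q.2, θ q.1 * deriv η q.2)

theorem continuous_tensorGrad {θ η : ℝ → ℝ} (hθ : ContDiff ℝ ∞ θ) (hη : ContDiff ℝ ∞ η) :
    Continuous (tensorGrad θ η) := by
  have h₁ := continuous_deriv_of_smooth hθ
  have h₂ := continuous_deriv_of_smooth hη
  have h₃ := hθ.continuous
  have h₄ := hη.continuous
  unfold tensorGrad
  fun_prop

theorem integrableOn_dot {R : Rect} {u h : ℝ × ℝ → ℝ × ℝ}
    (hu : MemLp u 2 (volume.restrict R.toSet)) (hh : Continuous h) :
    IntegrableOn (fun q => dot (u q) (h q)) R.toSet :=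
  (R.integrable_mul (integrableOn_fst hu) hh.fst).add
    (R.integrable_mul (integrableOn_snd hu) hh.snd)

/-! ### Corner estimates for square integrable fields -/

/-- The two ends of the strip of width `δ` to the left of the segment `{m} × [c, d]`. -/
def cornerBox (m c d δ : ℝ) : Set (ℝ × ℝ) :=
  Set.Icc (m - δ) m ×ˢ (Set.Icc c (c + 2 * δ) ∪ Set.Icc (d - 2 * δ) d)

theorem measurableSet_cornerBox (m c d δ : ℝ) : MeasurableSet (cornerBox m c d δ) :=
  measurableSet_Icc.prod (measurableSet_Icc.union measurableSet_Icc)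

theorem volume_cornerBox_le (m c d : ℝ) {δ : ℝ} (hδ : 0 < δ) :
    volume (cornerBox m c d δ) ≤ ENNReal.ofReal (4 * δ ^ 2) := by
  rw [cornerBox, Measure.volume_eq_prod, Measure.prod_prod]
  calc _ ≤ volume (Set.Icc (m - δ) m) *
        (volume (Set.Icc c (c + 2 * δ)) + volume (Set.Icc (d - 2 * δ) d)) := by
        gcongr; exact measure_union_le _ _
    _ = ENNReal.ofReal (4 * δ ^ 2) := by
        rw [Real.volume_Icc, Real.volume_Icc, Real.volume_Icc, ← ENNReal.ofReal_add (by linarith)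
          (by linarith), ← ENNReal.ofReal_mul (by linarith)]
        congr 1; ring

/-- The mean size of a field over the two boxes `cornerBox m c d δ`, multiplied by `δ`. -/
noncomputable def cornerFlux (R : Rect) (u : ℝ × ℝ → ℝ × ℝ) (m c d δ : ℝ) : ℝ :=
  δ⁻¹ * ∫ q in cornerBox m c d δ, (|(u q).1| + |(u q).2|) ∂(volume.restrict R.toSet)

/-- Cauchy-Schwarz bounds the quantity by twice the `L²` norm of `f` on `s δ`, which vanishes with
the measure of `s δ` by absolute continuity. A weighted pointwise inequality replaces Cauchy-Schwarz
in the proof. -/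
theorem tendsto_inv_mul_setIntegral {μ : Measure (ℝ × ℝ)} [IsFiniteMeasure μ] {f : ℝ × ℝ → ℝ}
    (hf : MemLp f 2 μ) {s : ℝ → Set (ℝ × ℝ)}
    (hμ : ∀ δ > 0, μ (s δ) ≤ ENNReal.ofReal (4 * δ ^ 2)) :
    Tendsto (fun δ => δ⁻¹ * ∫ q in s δ, |f q| ∂μ) (𝓝[>] 0) (𝓝 0) := by
  have hsq : Integrable (fun q => f q ^ 2) μ := hf.integrable_sq
  have hlim : Tendsto (fun δ => ∫ q in s δ, f q ^ 2 ∂μ) (𝓝[>] 0) (𝓝 0) := by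
    refine hsq.tendsto_setIntegral_nhds_zero ?_
    have h₀ : Tendsto (fun δ : ℝ => ENNReal.ofReal (4 * δ ^ 2)) (𝓝[>] 0) (𝓝 0) := by
      have : Tendsto (fun δ : ℝ => ENNReal.ofReal (4 * δ ^ 2)) (𝓝 0)
          (𝓝 (ENNReal.ofReal (4 * 0 ^ 2))) :=
        (ENNReal.continuous_ofReal.comp (by fun_prop)).tendsto 0
      simpa using this.mono_left nhdsWithin_le_nhds
    exact tendsto_of_tendsto_of_tendsto_of_le_of_le' tendsto_const_nhds h₀
      (.of_forall fun _ => zero_le) (by filter_upwards [self_mem_nhdsWithin] with δ hδ using hμ δ hδ)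
  rw [Metric.tendsto_nhds]
  intro τ hτ
  have hτ' : 0 < τ / 8 := by positivity
  have hsmall := hlim.eventually (gt_mem_nhds (show 0 < τ * (τ / 8) by positivity))
  filter_upwards [hsmall, self_mem_nhdsWithin] with δ hint hδ
  have hδ : 0 < δ := hδ
  -- Arithmetic-geometric mean inequality with weight `(τ / 8) / δ`: after integration the first
  -- term gives at most `δ * τ / 2` and the second less than `δ * τ / 4`.
  have hpt : ∀ q, |f q| ≤ (τ / 8) / δ + δ / (τ / 8) / 4 * f q ^ 2 := by
    intro q
    have := sq_nonneg ((τ / 8) - δ * |f q| / 2)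
    rw [← sq_abs (f q)]
    field_simp
    field_simp at this
    nlinarith
  have hle : ∫ q in s δ, |f q| ∂μ ≤
      ∫ q in s δ, ((τ / 8) / δ + δ / (τ / 8) / 4 * f q ^ 2) ∂μ := by
    refine integral_mono ((hf.integrable (by norm_num)).abs.integrableOn) ?_ hpt
    exact (integrable_const _).add (hsq.integrableOn.const_mul _)
  rw [integral_add (integrable_const _) (hsq.integrableOn.const_mul _), integral_const,
    integral_const_mul] at hle
  have hreal : (μ.restrict (s δ)).real Set.univ ≤ 4 * δ ^ 2 := by
    simp only [measureReal_def, Measure.restrict_apply_univ]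
    exact ENNReal.toReal_le_of_le_ofReal (by positivity) (hμ δ hδ)
  have h₁ : ∫ q in s δ, |f q| ∂μ < δ * τ := by
    calc _ ≤ _ := hle
      _ ≤ (4 * δ ^ 2) * ((τ / 8) / δ) + δ / (τ / 8) / 4 * ∫ q in s δ, f q ^ 2 ∂μ := by
        rw [smul_eq_mul]; gcongr
      _ < (4 * δ ^ 2) * ((τ / 8) / δ) + δ / (τ / 8) / 4 * (τ * (τ / 8)) := by gcongr
      _ ≤ δ * τ := by field_simp; norm_num
  rw [Real.dist_eq, sub_zero, abs_of_nonneg (mul_nonneg (by positivity)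
    (integral_nonneg fun _ => abs_nonneg _)), inv_mul_lt_iff₀ hδ]
  exact h₁

theorem tendsto_cornerFlux {R : Rect} {u : ℝ × ℝ → ℝ × ℝ}
    (hu : MemLp u 2 (volume.restrict R.toSet)) (m c d : ℝ) :
    Tendsto (cornerFlux R u m c d) (𝓝[>] 0) (𝓝 0) := by
  have hμ : ∀ δ > 0, (volume.restrict R.toSet) (cornerBox m c d δ) ≤
      ENNReal.ofReal (4 * δ ^ 2) := fun δ hδ =>
    (Measure.restrict_apply_le _ _).trans (volume_cornerBox_le m c d hδ)
  have h := (tendsto_inv_mul_setIntegral hu.fst hμ).add (tendsto_inv_mul_setIntegral hu.snd hμ)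
  rw [add_zero] at h
  refine h.congr fun δ => ?_
  rw [cornerFlux, integral_add, mul_add]
  · exact (integrableOn_fst hu).abs.integrableOn
  · exact (integrableOn_snd hu).abs.integrableOn

/-- Intended for `h` an error term from cutoffs at scale `δ`: its size `K / δ` supplies the factor
`δ⁻¹` of `cornerFlux`, and only the corner boxes contribute. -/
theorem abs_integral_dot_le_cornerFlux {R : Rect} {u h : ℝ × ℝ → ℝ × ℝ}
    (hu : MemLp u 2 (volume.restrict R.toSet)) {m c d δ K : ℝ}
    (hK : ∀ q, |(h q).1| ≤ K / δ ∧ |(h q).2| ≤ K / δ)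
    (hh : ∀ q ∈ R.toSet, q ∉ cornerBox m c d δ → h q = 0) :
    |∫ q in R.toSet, dot (u q) (h q)| ≤ K * cornerFlux R u m c d δ := by
  have hint : IntegrableOn (fun q => |(u q).1| + |(u q).2|) R.toSet :=
    (integrableOn_fst hu).abs.add (integrableOn_snd hu).abs
  have heq : K * cornerFlux R u m c d δ = ∫ q in R.toSet,
      (cornerBox m c d δ).indicator (fun q => K / δ * (|(u q).1| + |(u q).2|)) q := by
    rw [integral_indicator (measurableSet_cornerBox _ _ _ _), integral_const_mul, cornerFlux]
    ring
  rw [heq, ← Real.norm_eq_abs]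
  refine norm_integral_le_of_norm_le
    ((hint.const_mul _).indicator (measurableSet_cornerBox _ _ _ _)) ?_
  refine (ae_restrict_iff' R.measurableSet).2 (.of_forall fun q hq => ?_)
  by_cases hqB : q ∈ cornerBox m c d δ
  · rw [Set.indicator_of_mem hqB, Real.norm_eq_abs, dot]
    calc _ ≤ |(u q).1 * (h q).1| + |(u q).2 * (h q).2| := abs_add_le _ _
      _ ≤ |(u q).1| * (K / δ) + |(u q).2| * (K / δ) := by
        rw [abs_mul, abs_mul]
        have := hK q
        gcongr
        exacts [this.1, this.2]
      _ = _ := by ring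
  · simp [Set.indicator_of_notMem hqB, hh q hq hqB, dot]

/-! ### Unit flows and their fluxes through sections -/

/-- A square integrable field that is divergence free in the rectangle, has no flux through the
sides parallel to the first axis, and the total flux `1` through the two other sides. -/
structure IsUnitFlow (R : Rect) (u : ℝ × ℝ → ℝ × ℝ) : Prop where
  memLp : MemLp u 2 (volume.restrict R.toSet)
  flux : ∀ θ : ℝ → ℝ, ContDiff ℝ ∞ θ →
    ∫ q in R.toSet, (u q).1 * deriv θ q.1 = θ R.b - θ R.a
  noflow : ∀ θ η : ℝ → ℝ, ContDiff ℝ ∞ θ → ContDiff ℝ ∞ η → θ R.a = 0 → θ R.b = 0 →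
    ∫ q in R.toSet, dot (u q) (tensorGrad θ η q) = 0

theorem Rect.setIntegral_eq (R : Rect) {f : ℝ × ℝ → ℝ} (hf : IntegrableOn f R.toSet) :
    ∫ q in R.toSet, f q = ∫ x in Set.Ioo R.a R.b, ∫ y in Set.Ioo R.c R.d, f (x, y) :=
  setIntegral_prod f hf

theorem Rect.integrableOn_section (R : Rect) {f : ℝ × ℝ → ℝ} (hf : IntegrableOn f R.toSet) :
    IntegrableOn (fun x => ∫ y in Set.Ioo R.c R.d, f (x, y)) (Set.Ioo R.a R.b) := by
  have : Integrable f ((volume.restrict (Set.Ioo R.a R.b)).prod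
      (volume.restrict (Set.Ioo R.c R.d))) := by
    rw [Measure.prod_restrict]; exact hf
  exact this.integral_prod_left

theorem exists_smooth_primitive {g : ℝ → ℝ} (hg : ContDiff ℝ ∞ g) :
    ∃ θ : ℝ → ℝ, ContDiff ℝ ∞ θ ∧ deriv θ = g := by
  have hd : ∀ x, HasDerivAt (fun x => ∫ t in (0 : ℝ)..x, g t) (g x) x := fun x =>
    hg.continuous.integral_hasStrictDerivAt 0 x |>.hasDerivAt
  have hderiv : deriv (fun x => ∫ t in (0 : ℝ)..x, g t) = g := funext fun x => (hd x).deriv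
  refine ⟨_, ?_, hderiv⟩
  rw [contDiff_infty_iff_deriv]
  exact ⟨fun x => (hd x).differentiableAt, by rwa [hderiv]⟩

theorem setIntegral_deriv {θ : ℝ → ℝ} (hθ : ContDiff ℝ ∞ θ) {r s : ℝ} (hrs : r ≤ s) :
    ∫ x in Set.Ioo r s, deriv θ x = θ s - θ r := by
  rw [← integral_Ioc_eq_integral_Ioo, ← intervalIntegral.integral_of_le hrs]
  exact intervalIntegral.integral_deriv_eq_sub (fun x _ => differentiable_of_smooth hθ x)
    ((continuous_deriv_of_smooth hθ).intervalIntegrable _ _)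

variable {R : Rect} {u : ℝ × ℝ → ℝ × ℝ}

/-- The flux through almost every line parallel to the second axis is `1`. -/
theorem IsUnitFlow.section_eq_one (h : IsUnitFlow R u) (hab : R.a ≤ R.b) :
    ∀ᵐ x, x ∈ Set.Ioo R.a R.b → ∫ y in Set.Ioo R.c R.d, (u (x, y)).1 = 1 := by
  have hA := R.integrableOn_section (integrableOn_fst h.memLp)
  have hc : IntegrableOn (fun _ : ℝ => (1 : ℝ)) (Set.Ioo R.a R.b) :=
    integrableOn_const (by simp)
  have key := isOpen_Ioo.ae_eq_zero_of_integral_contDiff_smul_eq_zero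
    (μ := volume) (U := Set.Ioo R.a R.b)
    (f := fun x => (∫ y in Set.Ioo R.c R.d, (u (x, y)).1) - 1)
    (hA.sub hc).locallyIntegrableOn ?_
  · filter_upwards [key] with x hx hxm
    linarith [hx hxm]
  intro g hg hgc hgs
  -- Every test function is the derivative of an admissible `θ`, so `flux` identifies the pairing of
  -- the section flux with `g` as the integral of `g`; the fundamental lemma of the calculus of
  -- variations concludes.
  obtain ⟨θ, hθ, hd⟩ := exists_smooth_primitive hg
  have hgint : Integrable g := hg.continuous.integrable_of_hasCompactSupport hgc
  have hset : ∫ x, g x • ((∫ y in Set.Ioo R.c R.d, (u (x, y)).1) - 1) =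
      ∫ x in Set.Ioo R.a R.b, g x • ((∫ y in Set.Ioo R.c R.d, (u (x, y)).1) - 1) := by
    refine (setIntegral_eq_integral_of_forall_compl_eq_zero fun x hx => ?_).symm
    rw [image_eq_zero_of_notMem_tsupport (fun hx' => hx (hgs hx')), zero_smul]
  have hmul := R.integrable_mul (integrableOn_fst h.memLp) (hg.continuous.comp continuous_fst)
  have h₁ := h.flux θ hθ
  have h₂ := R.setIntegral_eq hmul
  have h₃ := R.integrableOn_section hmul
  have h₄ := setIntegral_deriv hθ hab
  simp only [Function.comp, integral_mul_const] at h₂ h₃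
  rw [hd] at h₁ h₄
  rw [hset]
  simp only [smul_eq_mul, mul_sub, mul_one]
  simp only [mul_comm (g _)]
  rw [integral_sub h₃ hgint.integrableOn, h₄, ← h₂, h₁, sub_self]

theorem Rect.toSet_subset {Q R : Rect} (ha : R.a ≤ Q.a) (hb : Q.b ≤ R.b) (hc : R.c ≤ Q.c)
    (hd : Q.d ≤ R.d) : Q.toSet ⊆ R.toSet :=
  Set.prod_mono (Set.Ioo_subset_Ioo ha hb) (Set.Ioo_subset_Ioo hc hd)

theorem IsUnitFlow.setIntegral_mul (h : IsUnitFlow R u) {r s : ℝ} (hr : R.a ≤ r) (hs : s ≤ R.b)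
    (hrs : r ≤ s) {g : ℝ → ℝ} (hg : Continuous g) :
    ∫ q in Rect.toSet ⟨r, s, R.c, R.d⟩, (u q).1 * g q.1 = ∫ x in Set.Ioo r s, g x := by
  have hsub : Rect.toSet ⟨r, s, R.c, R.d⟩ ⊆ R.toSet := Rect.toSet_subset hr hs le_rfl le_rfl
  have hmul := R.integrable_mul (integrableOn_fst h.memLp) (hg.comp continuous_fst)
  refine (Rect.setIntegral_eq _ (hmul.mono_set hsub)).trans ?_
  refine setIntegral_congr_ae measurableSet_Ioo ?_
  filter_upwards [h.section_eq_one (hr.trans (hrs.trans hs))] with x hx hxm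
  simp only [Function.comp, integral_mul_const]
  rw [hx ⟨hr.trans_lt hxm.1, hxm.2.trans_le hs⟩, one_mul]

theorem IsUnitFlow.setIntegral_fst (h : IsUnitFlow R u) {r s : ℝ} (hr : R.a ≤ r) (hs : s ≤ R.b)
    (hrs : r ≤ s) : ∫ q in Rect.toSet ⟨r, s, R.c, R.d⟩, (u q).1 = s - r := by
  have := h.setIntegral_mul hr hs hrs (g := fun _ => 1) continuous_const
  simpa [hrs] using this

/-- A unit flow is not orthogonal, on the part of the rectangle to the left of a line `x = m`, to
the gradients of all the functions `θ x * η y` that vanish near the lower and upper sides. -/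
theorem IsUnitFlow.exists_integral_ne_zero (h : IsUnitFlow R u) {m : ℝ} (ha : R.a < m)
    (hb : m ≤ R.b) : ∃ θ η : ℝ → ℝ, ContDiff ℝ ∞ θ ∧ ContDiff ℝ ∞ η ∧ tsupport η ⊆ Set.Ioo R.c R.d ∧
      ∫ q in Rect.toSet ⟨R.a, m, R.c, R.d⟩, dot (u q) (tensorGrad θ η q) ≠ 0 := by
  by_contra! hcon
  set Q : Rect := ⟨R.a, m, R.c, R.d⟩ with hQ
  have hsub : Q.toSet ⊆ R.toSet := Rect.toSet_subset le_rfl hb le_rfl le_rfl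
  have hu : MemLp u 2 (volume.restrict Q.toSet) :=
    h.memLp.mono_measure (Measure.restrict_mono_set _ hsub)
  have hlim := (tendsto_cornerFlux hu m R.c R.d).const_mul (2 * slope)
  rw [mul_zero] at hlim
  have hsmall := hlim.eventually (gt_mem_nhds one_pos)
  -- `δ` makes the corner error less than `1` and lets the ramp vanish at `R.a`.
  obtain ⟨δ, hδ1, hδ, hδm⟩ := (hsmall.and (Ioo_mem_nhdsGT (show 0 < m - R.a by linarith))).exists
  set θ := ramp m δ
  set η := cutoff R.c R.d δ
  have hθ : ContDiff ℝ ∞ θ := contDiff_ramp _ _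
  have hη : ContDiff ℝ ∞ η := contDiff_cutoff _ _ _
  have h₀ := hcon θ η hθ hη (tsupport_cutoff_subset hδ)
  have h₁ : ∫ q in Q.toSet, (u q).1 * deriv θ q.1 = 1 := by
    rw [h.setIntegral_mul le_rfl hb ha.le (continuous_deriv_of_smooth hθ),
      setIntegral_deriv hθ ha.le, show θ m = 1 from ramp_eq_one hδ le_rfl,
      show θ R.a = 0 from ramp_eq_zero hδ (by linarith), sub_zero]
  have hi₁ : IntegrableOn (fun q => (u q).1 * deriv θ q.1) Q.toSet :=
    Q.integrable_mul (integrableOn_fst hu) ((continuous_deriv_of_smooth hθ).comp continuous_fst)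
  have hi₂ : IntegrableOn (fun q => dot (u q) (tensorGrad θ η q)) Q.toSet :=
    integrableOn_dot hu (continuous_tensorGrad hθ hη)
  have h₂ := integral_sub hi₁ hi₂
  rw [h₁, h₀, sub_zero] at h₂
  -- This field is the gradient of `θ x` minus that of `θ x * η y`. The first pairs with `u` to `1`,
  -- the second to `0`, so a small corner error would have to equal `1`.
  have hbound := abs_integral_dot_le_cornerFlux hu (m := m) (c := R.c) (d := R.d) (δ := δ)
    (K := 2 * slope)
    (h := fun q => (deriv θ q.1 * (1 - η q.2), - (θ q.1 * deriv η q.2))) ?_ ?_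
  · have heq : ∀ q, (u q).1 * deriv θ q.1 - dot (u q) (tensorGrad θ η q) =
        dot (u q) (deriv θ q.1 * (1 - η q.2), - (θ q.1 * deriv η q.2)) := fun q => by
      simp only [dot, tensorGrad]; ring
    simp only [heq] at h₂
    rw [h₂, abs_one] at hbound
    linarith
  · intro q
    have := slope_pos
    constructor
    · simp only [abs_mul]
      have h1 : |1 - η q.2| ≤ 1 := by
        rw [abs_of_nonneg (by linarith [cutoff_le_one R.c R.d δ q.2])]
        linarith [cutoff_nonneg R.c R.d δ q.2]
      calc _ ≤ slope / δ * 1 := mul_le_mul (abs_deriv_ramp_le hδ _) h1 (abs_nonneg _) (by positivity)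
        _ ≤ _ := by rw [mul_one]; gcongr; linarith
    · simp only [abs_neg, abs_mul]
      rw [abs_of_nonneg (ramp_nonneg m δ _)]
      exact (mul_le_of_le_one_left (abs_nonneg _) (ramp_le_one _ _ _)).trans
        (abs_deriv_cutoff_le hδ _)
  · rintro q ⟨hq₁, hq₂⟩ hqB
    obtain ⟨hqa, hqm⟩ : R.a < q.1 ∧ q.1 < m := hq₁
    obtain ⟨hqc, hqd⟩ : R.c < q.2 ∧ q.2 < R.d := hq₂
    by_cases hx : q.1 < m - δ
    · simp [θ, deriv_ramp_eq_zero hδ (.inl hx), ramp_eq_zero hδ hx.le]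
    · have hc : R.c + 2 * δ < q.2 := by
        by_contra! hc
        exact hqB ⟨⟨not_lt.1 hx, hqm.le⟩, .inl ⟨hqc.le, hc⟩⟩
      have hd : q.2 < R.d - 2 * δ := by
        by_contra! hd
        exact hqB ⟨⟨not_lt.1 hx, hqm.le⟩, .inr ⟨hd, hqd.le⟩⟩
      simp [η, deriv_cutoff_eq_zero hδ hc hd, cutoff_eq_one hδ hc.le hd.le]

/-! ### No concentration of flux at the end points -/

/-- Near the line `x = m`, the flux through the middle part of a vertical section is almost `1`,
uniformly in the width of the averaging strip. -/
theorem IsUnitFlow.abs_one_sub_integral_le (h : IsUnitFlow R u) {m δ ε : ℝ} (hε : 0 < ε)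
    (hεδ : ε ≤ δ) (hm : δ < m - R.a) (hb : m ≤ R.b) :
    |1 - ∫ q in R.toSet, (u q).1 * (deriv (ramp m ε) q.1 * cutoff R.c R.d δ q.2)| ≤
      2 * slope * cornerFlux R u m R.c R.d δ := by
  have hδ : 0 < δ := hε.trans_le hεδ
  have hu := h.memLp
  set θ := ramp m ε with hθdef
  set ϑ := ramp m δ with hϑdef
  set η := cutoff R.c R.d δ
  have hθ : ContDiff ℝ ∞ θ := contDiff_ramp _ _
  have hϑ : ContDiff ℝ ∞ ϑ := contDiff_ramp _ _
  have hη : ContDiff ℝ ∞ η := contDiff_cutoff _ _ _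
  have hdθ := continuous_deriv_of_smooth hθ
  have hdϑ := continuous_deriv_of_smooth hϑ
  have hηc := hη.continuous
  have h₁ : ∫ q in R.toSet, (u q).1 * deriv θ q.1 = 1 := by
    rw [h.flux θ hθ, show θ R.b = 1 from ramp_eq_one hε hb,
      show θ R.a = 0 from ramp_eq_zero hε (by linarith), sub_zero]
  have hζ : ContDiff ℝ ∞ fun y => 1 - η y := contDiff_const.sub hη
  -- The difference of the ramps of widths `ε` and `δ` vanishes at both ends, as `noflow` demands.
  -- It trades the steep derivative `deriv θ`, of order `1 / ε`, for `deriv ϑ`, of order `1 / δ`, so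
  -- that the error does not depend on `ε`.
  have h₀ := h.noflow (fun x => θ x - ϑ x) (fun y => 1 - η y) (hθ.sub hϑ) hζ
    (by simp only [hθdef, hϑdef]; rw [ramp_eq_zero hε (by linarith),
          ramp_eq_zero hδ (by linarith), sub_zero])
    (by simp only [hθdef, hϑdef]; rw [ramp_eq_one hε hb, ramp_eq_one hδ hb, sub_self])
  have hgrad : ∀ q, tensorGrad (fun x => θ x - ϑ x) (fun y => 1 - η y) q =
      ((deriv θ q.1 - deriv ϑ q.1) * (1 - η q.2), -((θ q.1 - ϑ q.1) * deriv η q.2)) := by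
    intro q
    have e₁ : deriv (fun x => θ x - ϑ x) q.1 = deriv θ q.1 - deriv ϑ q.1 :=
      deriv_fun_sub (differentiable_of_smooth hθ _) (differentiable_of_smooth hϑ _)
    have e₂ : deriv (fun y => 1 - η y) q.2 = - deriv η q.2 := by simp
    simp only [tensorGrad, e₁, e₂, mul_neg]
  have hi₀ := integrableOn_dot hu (continuous_tensorGrad (hθ.sub hϑ) hζ)
  have hi₁ : IntegrableOn (fun q => (u q).1 * deriv θ q.1) R.toSet :=
    R.integrable_mul (integrableOn_fst hu) (by fun_prop)
  have hi₂ : IntegrableOn (fun q => (u q).1 * (deriv θ q.1 * η q.2)) R.toSet :=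
    R.integrable_mul (integrableOn_fst hu) (h := fun q => deriv θ q.1 * η q.2) (by fun_prop)
  have h₂ := integral_sub (hi₁.sub hi₂) hi₀
  simp only [Pi.sub_apply] at h₂
  rw [integral_sub hi₁ hi₂, h₁, h₀, sub_zero] at h₂
  have heq : ∀ q, (u q).1 * deriv θ q.1 - (u q).1 * (deriv θ q.1 * η q.2) -
      dot (u q) (tensorGrad (fun x => θ x - ϑ x) (fun y => 1 - η y) q) =
      dot (u q) (deriv ϑ q.1 * (1 - η q.2), (θ q.1 - ϑ q.1) * deriv η q.2) := fun q => by
    rw [hgrad]; simp only [dot]; ring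
  simp only [heq] at h₂
  rw [← h₂]
  apply abs_integral_dot_le_cornerFlux hu
  · intro q
    have := slope_pos
    constructor
    · simp only [abs_mul]
      have h1 : |1 - η q.2| ≤ 1 := by
        rw [abs_of_nonneg (by linarith [cutoff_le_one R.c R.d δ q.2])]
        linarith [cutoff_nonneg R.c R.d δ q.2]
      calc _ ≤ slope / δ * 1 := mul_le_mul (abs_deriv_ramp_le hδ _) h1 (abs_nonneg _) (by positivity)
        _ ≤ _ := by rw [mul_one]; gcongr; linarith
    · simp only [abs_mul]
      refine (mul_le_of_le_one_left (abs_nonneg _) ?_).trans (abs_deriv_cutoff_le hδ _)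
      rw [abs_le]
      constructor <;> linarith [ramp_nonneg m ε q.1, ramp_nonneg m δ q.1, ramp_le_one m ε q.1,
        ramp_le_one m δ q.1]
  · rintro q ⟨hq₁, hq₂⟩ hqB
    obtain ⟨hqa, hqb⟩ : R.a < q.1 ∧ q.1 < R.b := hq₁
    obtain ⟨hqc, hqd⟩ : R.c < q.2 ∧ q.2 < R.d := hq₂
    by_cases hx : q.1 < m - δ
    · simp [θ, ϑ, deriv_ramp_eq_zero hδ (.inl hx), ramp_eq_zero hδ hx.le,
        ramp_eq_zero hε (show q.1 ≤ m - ε by linarith)]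
    by_cases hx' : m < q.1
    · simp [θ, ϑ, deriv_ramp_eq_zero hδ (.inr hx'), ramp_eq_one hδ hx'.le, ramp_eq_one hε hx'.le]
    · have hc : R.c + 2 * δ < q.2 := by
        by_contra! hc
        exact hqB ⟨⟨not_lt.1 hx, not_lt.1 hx'⟩, .inl ⟨hqc.le, hc⟩⟩
      have hd : q.2 < R.d - 2 * δ := by
        by_contra! hd
        exact hqB ⟨⟨not_lt.1 hx, not_lt.1 hx'⟩, .inr ⟨hd, hqd.le⟩⟩
      simp [η, deriv_cutoff_eq_zero hδ hc hd, cutoff_eq_one hδ hc.le hd.le]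

/-- The averages of `g` over thin strips to the left of a segment tend to the integral of `g` over
the segment, when `g` is continuous there and weighted with a cutoff function. -/
theorem tendsto_integral_ramp_cutoff {g : ℝ × ℝ → ℝ} {m δ : ℝ} (hcd : R.c ≤ R.d) (hδ : 0 < δ)
    (ha : R.a < m) (hb : m ≤ R.b) (hgR : IntegrableOn g R.toSet)
    (hg : ∀ y ∈ Set.Ioo R.c R.d, ContinuousAt g (m, y))
    (hgm : IntegrableOn (fun y => g (m, y)) (Set.Ioo R.c R.d)) :
    Tendsto (fun ε => ∫ q in R.toSet, g q * (deriv (ramp m ε) q.1 * cutoff R.c R.d δ q.2))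
      (𝓝[>] 0) (𝓝 (∫ y in Set.Ioo R.c R.d, g (m, y) * cutoff R.c R.d δ y)) := by
  rw [Metric.tendsto_nhds]
  intro τ hτ
  set η := cutoff R.c R.d δ
  have hηc : Continuous η := (contDiff_cutoff _ _ _).continuous
  obtain ⟨τ', hτ', hττ⟩ : ∃ τ' > 0, τ' * (R.d - R.c) < τ := by
    refine ⟨τ / (R.d - R.c + 1), div_pos hτ (by linarith), ?_⟩
    rw [div_mul_eq_mul_div, div_lt_iff₀ (by linarith)]
    nlinarith
  have hK : IsCompact (({m} : Set ℝ) ×ˢ Set.Icc (R.c + δ) (R.d - δ)) :=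
    isCompact_singleton.prod isCompact_Icc
  -- The cutoff leaves only a compact part of the open segment, on which pointwise continuity
  -- becomes uniform closeness of `g q` and `g (m, q.2)`.
  have hunif := hK.uniformContinuousAt_of_continuousAt g ?_ (Metric.dist_mem_uniformity hτ')
  swap
  · rintro ⟨x, y⟩ ⟨hx, hy⟩
    obtain rfl : x = m := hx
    exact hg y ⟨by linarith [hy.1], by linarith [hy.2]⟩
  obtain ⟨ρ, hρ, hclose⟩ := Metric.mem_uniformity_dist.1 hunif
  have hmin : 0 < min ρ (m - R.a) := lt_min hρ (by linarith)
  filter_upwards [Ioo_mem_nhdsGT hmin] with ε hε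
  obtain ⟨hε, hεmin⟩ := hε
  have hερ : ε < ρ := hεmin.trans_le (min_le_left _ _)
  have hεm : ε < m - R.a := hεmin.trans_le (min_le_right _ _)
  set θ := ramp m ε
  have hθ : ContDiff ℝ ∞ θ := contDiff_ramp _ _
  have hdθ := continuous_deriv_of_smooth hθ
  have hθ1 : ∫ x in Set.Ioo R.a R.b, deriv θ x = 1 := by
    rw [setIntegral_deriv hθ (ha.le.trans hb), show θ R.b = 1 from ramp_eq_one hε hb,
      show θ R.a = 0 from ramp_eq_zero hε (by linarith), sub_zero]
  -- The derivative of the ramp is a probability density in the first variable, so the limit itself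
  -- can be written as an integral over the rectangle.
  have hprod : ∫ q in R.toSet, deriv θ q.1 * (g (m, q.2) * η q.2) =
      ∫ y in Set.Ioo R.c R.d, g (m, y) * η y := by
    have := setIntegral_prod_mul (μ := volume) (ν := volume) (deriv θ)
      (fun y => g (m, y) * η y) (Set.Ioo R.a R.b) (Set.Ioo R.c R.d)
    rw [hθ1, one_mul] at this
    exact this
  have hi₁ : IntegrableOn (fun q => g q * (deriv θ q.1 * η q.2)) R.toSet :=
    R.integrable_mul hgR (h := fun q => deriv θ q.1 * η q.2) (by fun_prop)
  have hi₂ : IntegrableOn (fun q => deriv θ q.1 * (g (m, q.2) * η q.2)) R.toSet := by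
    have hη1 : IntegrableOn (fun y => g (m, y) * η y) (Set.Ioo R.c R.d) := by
      refine Integrable.mul_bdd (c := 1) hgm hηc.aestronglyMeasurable (.of_forall fun y => ?_)
      rw [Real.norm_of_nonneg (cutoff_nonneg _ _ _ _)]
      exact cutoff_le_one _ _ _ _
    have hθi : IntegrableOn (deriv θ) (Set.Ioo R.a R.b) :=
      hdθ.integrableOn_Icc.mono_set Set.Ioo_subset_Icc_self
    have := Integrable.mul_prod hθi hη1
    rw [Measure.prod_restrict] at this
    exact this
  have hi₃ : IntegrableOn (fun q : ℝ × ℝ => deriv θ q.1 * τ') R.toSet := by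
    have := R.integrable_mul (f := fun _ => τ') (integrableOn_const R.volume_lt_top.ne)
      (h := fun q => deriv θ q.1) (by fun_prop)
    simpa only [mul_comm] using this
  have hI₃ : ∫ q in R.toSet, deriv θ q.1 * τ' = τ' * (R.d - R.c) := by
    have := setIntegral_prod_mul (μ := volume) (ν := volume) (deriv θ)
      (fun _ : ℝ => τ') (Set.Ioo R.a R.b) (Set.Ioo R.c R.d)
    rw [hθ1, one_mul, setIntegral_const, Real.volume_real_Ioo_of_le hcd, smul_eq_mul,
      mul_comm (R.d - R.c)] at this
    exact this
  rw [← hprod, Real.dist_eq, ← integral_sub hi₁ hi₂, ← Real.norm_eq_abs]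
  refine (norm_integral_le_of_norm_le hi₃ (.of_forall fun q => ?_)).trans_lt (hI₃.trans_lt hττ)
  have hθ0 : 0 ≤ deriv θ q.1 := deriv_ramp_nonneg hε _
  have hfac : g q * (deriv θ q.1 * η q.2) - deriv θ q.1 * (g (m, q.2) * η q.2) =
      deriv θ q.1 * ((g q - g (m, q.2)) * η q.2) := by ring
  rw [hfac, norm_mul, Real.norm_of_nonneg hθ0]
  by_cases hx : q.1 < m - ε ∨ m < q.1
  · rw [show deriv θ q.1 = 0 from deriv_ramp_eq_zero hε hx, zero_mul, zero_mul]
  refine mul_le_mul_of_nonneg_left ?_ hθ0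
  push Not at hx
  by_cases hy : q.2 ≤ R.c + δ ∨ R.d - δ ≤ q.2
  · rw [show η q.2 = 0 from cutoff_eq_zero hδ hy, mul_zero, norm_zero]
    exact hτ'.le
  push Not at hy
  have hd : dist ((m, q.2) : ℝ × ℝ) q < ρ := by
    rw [Prod.dist_eq, dist_self, max_lt_iff, Real.dist_eq, abs_lt]
    exact ⟨⟨by linarith, by linarith⟩, hρ⟩
  have hdist := hclose hd ⟨rfl, hy.1.le, hy.2.le⟩
  simp only [Set.mem_ofPred_eq] at hdist
  rw [dist_comm, Real.dist_eq] at hdist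
  rw [norm_mul, Real.norm_eq_abs, Real.norm_of_nonneg (cutoff_nonneg _ _ _ _)]
  exact (mul_le_of_le_one_right (abs_nonneg _) (cutoff_le_one _ _ _ _)).trans hdist.le

/-- Dominated convergence: each point of `(c, d)` eventually lies where the cutoff is `1`. -/
theorem tendsto_integral_mul_cutoff {f : ℝ → ℝ} {c d : ℝ} (hf : IntegrableOn f (Set.Ioo c d)) :
    Tendsto (fun δ => ∫ y in Set.Ioo c d, f y * cutoff c d δ y) (𝓝[>] 0)
      (𝓝 (∫ y in Set.Ioo c d, f y)) := by
  refine tendsto_integral_filter_of_dominated_convergence (fun y => ‖f y‖) ?_ ?_ hf.norm ?_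
  · exact .of_forall fun δ => hf.aestronglyMeasurable.mul
      (contDiff_cutoff _ _ _).continuous.aestronglyMeasurable
  · refine .of_forall fun δ => .of_forall fun y => ?_
    rw [norm_mul, Real.norm_of_nonneg (cutoff_nonneg _ _ _ _)]
    exact mul_le_of_le_one_right (norm_nonneg _) (cutoff_le_one _ _ _ _)
  · refine (ae_restrict_iff' measurableSet_Ioo).2 (.of_forall fun y hy => ?_)
    have hpos : 0 < min ((y - c) / 2) ((d - y) / 2) :=
      lt_min (by linarith [hy.1]) (by linarith [hy.2])
    refine tendsto_const_nhds.congr' ?_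
    filter_upwards [Ioo_mem_nhdsGT hpos] with δ hδ
    have h₁ := hδ.2.trans_le (min_le_left _ _)
    have h₂ := hδ.2.trans_le (min_le_right _ _)
    rw [cutoff_eq_one hδ.1 (by linarith) (by linarith), mul_one]

/-- If the first component of a unit flow is represented by a function that is continuous on a
vertical section and integrable there, then its integral over this section is `1`: no flux can
concentrate in the end points. -/
theorem IsUnitFlow.intervalIntegral_eq_one (h : IsUnitFlow R u) {m : ℝ} (ha : R.a < m)
    (hb : m ≤ R.b) (hcd : R.c ≤ R.d) {g : ℝ × ℝ → ℝ}
    (hgu : g =ᵐ[volume.restrict R.toSet] fun q => (u q).1)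
    (hg : ∀ y ∈ Set.Ioo R.c R.d, ContinuousAt g (m, y))
    (hgm : IntervalIntegrable (fun y => g (m, y)) volume R.c R.d) :
    ∫ y in R.c..R.d, g (m, y) = 1 := by
  have hgm' : IntegrableOn (fun y => g (m, y)) (Set.Ioo R.c R.d) :=
    ((intervalIntegrable_iff_integrableOn_Ioc_of_le hcd).1 hgm).mono_set Set.Ioo_subset_Ioc_self
  rw [intervalIntegral.integral_of_le hcd, integral_Ioc_eq_integral_Ioo]
  have hgR : IntegrableOn g R.toSet := (integrableOn_fst h.memLp).congr hgu.symm
  have hlim := (tendsto_integral_mul_cutoff hgm').const_sub 1 |>.abs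
  have herr := (tendsto_cornerFlux h.memLp m R.c R.d).const_mul (2 * slope)
  rw [mul_zero] at herr
  have hle := le_of_tendsto_of_tendsto hlim herr ?_
  · have := abs_nonpos_iff.1 hle
    linarith
  filter_upwards [Ioo_mem_nhdsGT (show 0 < m - R.a by linarith)] with δ hδ
  -- At fixed `δ` the width `ε` tends to `0`; the outer limit in `δ` then removes the corner error.
  refine le_of_tendsto
    ((tendsto_integral_ramp_cutoff hcd hδ.1 ha hb hgR hg hgm').const_sub 1 |>.abs) ?_
  filter_upwards [Ioo_mem_nhdsGT hδ.1] with ε hε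
  have := h.abs_one_sub_integral_le hε.1 hε.2.le hδ.2 hb
  rwa [integral_congr_ae (g := fun q => g q * (deriv (ramp m ε) q.1 * cutoff R.c R.d δ q.2))]
    at this
  filter_upwards [hgu] with q hq
  rw [hq]

/-! ### Coordinates along the normal of an interface and along the interface -/

/-- The coordinates along the flux direction and perpendicular to it. -/
def Direction.frame : Direction → ℝ × ℝ → ℝ × ℝ
  | .horizontal, p => p
  | .vertical, p => p.swap

/-- A rectangle in the coordinates `Direction.frame`. -/
def Direction.rect : Direction → Rect → Rect
  | .horizontal, R => R
  | .vertical, R => ⟨R.c, R.d, R.a, R.b⟩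

/-- A vector field in the coordinates `Direction.frame`. -/
def Direction.field (D : Direction) (u : ℝ × ℝ → ℝ × ℝ) (q : ℝ × ℝ) : ℝ × ℝ :=
  D.frame (u (D.frame q))

theorem Direction.continuous_frame (D : Direction) : Continuous D.frame := by
  cases D
  exacts [continuous_id, continuous_swap]

@[simp] theorem Direction.frame_frame (D : Direction) (p : ℝ × ℝ) : D.frame (D.frame p) = p := by
  cases D <;> rfl

theorem Direction.rect_rect (D : Direction) (R : Rect) : D.rect (D.rect R) = R := by
  cases D <;> rfl

theorem Direction.dot_frame (D : Direction) (p q : ℝ × ℝ) :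
    dot (D.frame p) (D.frame q) = dot p q := by
  cases D
  · rfl
  · exact add_comm _ _

theorem Direction.frame_mem_iff (D : Direction) (R : Rect) (p : ℝ × ℝ) :
    D.frame p ∈ (D.rect R).toSet ↔ p ∈ R.toSet := by
  cases D
  · rfl
  · exact and_comm

theorem Direction.measurePreserving_frame (D : Direction) :
    MeasurePreserving D.frame volume volume := by
  cases D
  · exact MeasurePreserving.id _
  · exact Measure.measurePreserving_swap

theorem Direction.measurableEmbedding_frame (D : Direction) : MeasurableEmbedding D.frame := by
  cases D
  · exact MeasurableEmbedding.id
  · exact MeasurableEquiv.prodComm.measurableEmbedding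

theorem Direction.preimage_frame (D : Direction) (R : Rect) :
    D.frame ⁻¹' R.toSet = (D.rect R).toSet := by
  ext p
  rw [Set.mem_preimage, ← D.frame_mem_iff, D.frame_frame]

theorem Direction.setIntegral_frame (D : Direction) (R : Rect) (f : ℝ × ℝ → ℝ) :
    ∫ q in (D.rect R).toSet, f (D.frame q) = ∫ p in R.toSet, f p := by
  rw [← D.preimage_frame]
  exact D.measurePreserving_frame.setIntegral_preimage_emb D.measurableEmbedding_frame f _

theorem Direction.setIntegral_dot_frame (D : Direction) (R : Rect) (u V : ℝ × ℝ → ℝ × ℝ) :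
    ∫ q in (D.rect R).toSet, dot (D.field u q) (V q) =
      ∫ p in R.toSet, dot (u p) (D.frame (V (D.frame p))) := by
  rw [← D.setIntegral_frame R fun p => dot (u p) (D.frame (V (D.frame p)))]
  refine integral_congr_ae (.of_forall fun q => ?_)
  simp only [D.frame_frame]
  exact (D.dot_frame _ _).symm.trans (by simp [Direction.field])

theorem Direction.memLp_field (D : Direction) {R : Rect} {u : ℝ × ℝ → ℝ × ℝ}
    (hu : MemLp u 2 (volume.restrict R.toSet)) :
    MemLp (D.field u) 2 (volume.restrict (D.rect R).toSet) := by
  have hmp := D.measurePreserving_frame.restrict_preimage R.measurableSet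
  rw [D.preimage_frame] at hmp
  have h := hu.comp_measurePreserving hmp
  cases D
  · exact h
  -- `ℝ × ℝ` carries the maximum norm, which is invariant under the swap.
  · exact ⟨continuous_swap.comp_aestronglyMeasurable h.1,
      (eLpNorm_congr_norm_ae (.of_forall fun q => max_comm _ _)).trans_lt h.2⟩

/-! ### Solutions of the local problems as unit flows -/

theorem contDiff_tensor {θ η : ℝ → ℝ} (hθ : ContDiff ℝ ∞ θ) (hη : ContDiff ℝ ∞ η) :
    ContDiff ℝ ∞ fun p : ℝ × ℝ => θ p.1 * η p.2 :=
  (hθ.comp contDiff_fst).mul (hη.comp contDiff_snd)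

theorem grad_tensor {θ η : ℝ → ℝ} (hθ : ContDiff ℝ ∞ θ) (hη : ContDiff ℝ ∞ η) (p : ℝ × ℝ) :
    grad (fun p => θ p.1 * η p.2) p = tensorGrad θ η p := by
  have h₁ : HasFDerivAt (fun p : ℝ × ℝ => θ p.1) _ p :=
    (differentiable_of_smooth hθ p.1).hasDerivAt.hasFDerivAt.comp p hasFDerivAt_fst
  have h₂ : HasFDerivAt (fun p : ℝ × ℝ => η p.2) _ p :=
    (differentiable_of_smooth hη p.2).hasDerivAt.hasFDerivAt.comp p hasFDerivAt_snd
  have h : HasFDerivAt (fun p : ℝ × ℝ => θ p.1 * η p.2) _ p := h₁.mul h₂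
  simp only [grad, tensorGrad, h.fderiv]
  ext
  · simp [mul_comm]
  · simp

variable {k : ℝ × ℝ → (ℝ × ℝ →ₗ[ℝ] ℝ × ℝ)} {g : Side → ℝ × ℝ → ℝ}
  {φ : ℝ × ℝ → ℝ} {G : ℝ × ℝ → ℝ × ℝ}

theorem IsNeumannSolution.memLp_indicator (h : IsNeumannSolution R k g φ G) :
    MemLp (R.toSet.indicator fun p => -(k p (G p))) 2 volume :=
  (memLp_indicator_iff_restrict R.measurableSet).2 h.memLp_flux

theorem IsNeumannSolution.integral_tensor (h : IsNeumannSolution R k g φ G) {θ η : ℝ → ℝ}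
    (hθ : ContDiff ℝ ∞ θ) (hη : ContDiff ℝ ∞ η) :
    ∫ q in R.toSet, dot (R.toSet.indicator (fun p => -(k p (G p))) q) (tensorGrad θ η q) =
      R.boundaryIntegral fun s p => g s p * (θ p.1 * η p.2) := by
  rw [← h.weak_form _ (contDiff_tensor hθ hη)]
  refine setIntegral_congr_fun R.measurableSet fun q hq => ?_
  simp only [Set.indicator_of_mem hq, grad_tensor hθ hη]

/-- A function of the flux coordinate alone is constant on the inflow and outflow sides, so it sees
only the totals, normalized to `-1` and `1`. If it vanishes on these sides, only the sides with zero
datum remain, and any tangential factor is allowed. -/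
theorem IsNeumannSolution.isUnitFlow {v : ℝ × ℝ → ℝ × ℝ} {D : Direction}
    (h : IsNeumannSolution R k (boundaryFlux R v D) φ G)
    (hin : R.sideFlux v D.inflow ≠ 0) (hout : R.sideFlux v D.outflow ≠ 0) :
    IsUnitFlow (D.rect R) (D.field (R.toSet.indicator fun p => -(k p (G p)))) := by
  have hone : ContDiff ℝ ∞ fun _ : ℝ => (1 : ℝ) := contDiff_const
  have hmem := D.memLp_field (h.memLp_indicator.restrict R.toSet)
  cases D
  · refine ⟨hmem, fun θ hθ => ?_, fun θ η hθ hη ha hb => ?_⟩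
    · have h₁ := h.integral_tensor hθ hone
      have h₂ : (∫ t in R.c..R.d, dot (v (R.a, t)) Side.left.normal) =
        R.sideFlux v .left := rfl
      have h₃ : (∫ t in R.c..R.d, dot (v (R.b, t)) Side.right.normal) =
        R.sideFlux v .right := rfl
      simp only [Rect.boundaryIntegral, Rect.sideIntegral, boundaryFlux, mul_one, zero_mul,
        intervalIntegral.integral_zero, intervalIntegral.integral_mul_const,
        intervalIntegral.integral_neg, intervalIntegral.integral_div, h₂, h₃] at h₁
      rw [show R.sideFlux v .left / R.sideFlux v .left = 1 from div_self hin,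
        show R.sideFlux v .right / R.sideFlux v .right = 1 from div_self hout] at h₁
      simp only [dot, tensorGrad, deriv_const, mul_zero, add_zero, mul_one] at h₁
      simp only [Direction.rect, Direction.field, Direction.frame, h₁]
      ring
    · refine (h.integral_tensor hθ hη).trans ?_
      replace ha : θ R.a = 0 := ha
      replace hb : θ R.b = 0 := hb
      have hside : ∀ s, R.sideIntegral s
          (fun p => boundaryFlux R v .horizontal s p * (θ p.1 * η p.2)) = 0 := fun s => by
        cases s <;> simp [Rect.sideIntegral, boundaryFlux, ha, hb]
      rw [Rect.boundaryIntegral, hside, hside, hside, hside]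
      norm_num
  -- Swapping the coordinates exchanges the two factors of the test function, which reduces the
  -- vertical case to the same computation.
  · have hswap := fun θ η : ℝ → ℝ => (Direction.vertical.setIntegral_dot_frame R
      (R.toSet.indicator fun p => -(k p (G p))) (tensorGrad θ η)).trans
        (integral_congr_ae (.of_forall fun p => congrArg _ (show _ = tensorGrad η θ p by
          simp [Direction.frame, tensorGrad, mul_comm])))
    refine ⟨hmem, fun θ hθ => ?_, fun θ η hθ hη ha hb => ?_⟩
    · have h₁ := h.integral_tensor hone hθ
      rw [← hswap] at h₁
      have h₂ : (∫ t in R.a..R.b, dot (v (t, R.c)) Side.bottom.normal) =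
        R.sideFlux v .bottom := rfl
      have h₃ : (∫ t in R.a..R.b, dot (v (t, R.d)) Side.top.normal) =
        R.sideFlux v .top := rfl
      simp only [Rect.boundaryIntegral, Rect.sideIntegral, boundaryFlux, one_mul, zero_mul,
        intervalIntegral.integral_zero, intervalIntegral.integral_mul_const,
        intervalIntegral.integral_neg, intervalIntegral.integral_div, h₂, h₃] at h₁
      rw [show R.sideFlux v .bottom / R.sideFlux v .bottom = 1 from div_self hin,
        show R.sideFlux v .top / R.sideFlux v .top = 1 from div_self hout] at h₁
      simp only [dot, tensorGrad, deriv_const, mul_zero, add_zero, mul_one] at h₁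
      rw [h₁]
      simp only [Direction.rect]
      ring
    · have h₁ := h.integral_tensor hη hθ
      rw [← hswap] at h₁
      refine h₁.trans ?_
      replace ha : θ R.c = 0 := ha
      replace hb : θ R.d = 0 := hb
      have hside : ∀ s, R.sideIntegral s
          (fun p => boundaryFlux R v .vertical s p * (η p.1 * θ p.2)) = 0 := fun s => by
        cases s <;> simp [Rect.sideIntegral, boundaryFlux, ha, hb]
      rw [Rect.boundaryIntegral, hside, hside, hside, hside]
      norm_num

/-! ### Geometry of the interfaces -/

/-- The middle of the interval `[x i, x (i + 1)]`. -/
noncomputable def mid (x : ℤ → ℝ) (i : ℤ) : ℝ := (x i + x (i + 1)) / 2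

/-- The lower end of a half of the interval `[x i, x (i + 1)]`. -/
noncomputable def halfLo (x : ℤ → ℝ) (i : ℤ) : Half → ℝ
  | .first => x i
  | .second => mid x i

/-- The upper end of a half of the interval `[x i, x (i + 1)]`. -/
noncomputable def halfHi (x : ℤ → ℝ) (i : ℤ) : Half → ℝ
  | .first => mid x i
  | .second => x (i + 1)

section Line

variable {x : ℤ → ℝ} (hx : StrictMono x)
include hx

theorem lt_mid (i : ℤ) : x i < mid x i := by
  have := hx (lt_add_one i); unfold mid; linarith

theorem mid_lt (i : ℤ) : mid x i < x (i + 1) := by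
  have := hx (lt_add_one i); unfold mid; linarith

theorem halfLo_lt_halfHi (i : ℤ) (h : Half) : halfLo x i h < halfHi x i h := by
  cases h
  exacts [lt_mid hx i, mid_lt hx i]

theorem le_halfLo (i : ℤ) (h : Half) : x i ≤ halfLo x i h := by
  cases h
  exacts [le_rfl, (lt_mid hx i).le]

theorem halfHi_le (i : ℤ) (h : Half) : halfHi x i h ≤ x (i + 1) := by
  cases h
  exacts [(mid_lt hx i).le, le_rfl]

theorem halfHi_le_halfLo_of_lt {i j : ℤ} (hij : i < j) (h h' : Half) :
    halfHi x i h ≤ halfLo x j h' :=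
  (halfHi_le hx i h).trans ((hx.monotone hij).trans (le_halfLo hx j h'))

theorem halves_disjoint {i j : ℤ} {h h' : Half} (hne : ¬(i = j ∧ h = h')) :
    halfHi x i h ≤ halfLo x j h' ∨ halfHi x j h' ≤ halfLo x i h := by
  rcases lt_trichotomy i j with hij | rfl | hij
  · exact .inl (halfHi_le_halfLo_of_lt hx hij h h')
  · cases h <;> cases h' <;> simp_all [halfHi, halfLo]
  · exact .inr (halfHi_le_halfLo_of_lt hx hij h' h)

theorem mid_le_mid {i j : ℤ} (hij : i ≤ j) : mid x i ≤ mid x j := by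
  have h₁ := hx.monotone hij
  have h₂ := hx.monotone (add_le_add_left hij 1)
  unfold mid; linarith

/-- Centers are end points of halves, so an interval between consecutive centers cannot cut a half:
it contains the half or misses its interior. -/
theorem half_subset_or_disjoint (i j : ℤ) (h : Half) :
    (mid x j ≤ halfLo x i h ∧ halfHi x i h ≤ mid x (j + 1)) ∨
      halfHi x i h ≤ mid x j ∨ mid x (j + 1) ≤ halfLo x i h := by
  have h₁ := lt_mid hx
  have h₂ := mid_lt hx
  cases h
  · simp only [halfLo, halfHi]
    rcases lt_trichotomy i (j + 1) with hij | rfl | hij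
    · exact .inr (.inl (mid_le_mid hx (by omega)))
    · exact .inl ⟨(h₂ j).le, le_rfl⟩
    · exact .inr (.inr ((h₂ _).le.trans (hx.monotone (by omega))))
  · simp only [halfLo, halfHi]
    rcases lt_trichotomy i j with hij | rfl | hij
    · exact .inr (.inl ((hx.monotone (by omega)).trans (h₁ _).le))
    · exact .inl ⟨le_rfl, (h₁ _).le⟩
    · exact .inr (.inr (mid_le_mid hx (by omega)))

end Line

theorem Rect.disjoint_of_fst {Q R : Rect} (h : Q.b ≤ R.a ∨ R.b ≤ Q.a) :
    Disjoint Q.toSet R.toSet := by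
  rw [Set.disjoint_left]
  rintro p ⟨⟨h₁, h₂⟩, -⟩ ⟨⟨h₃, h₄⟩, -⟩
  rcases h with h | h
  · exact absurd (h₂.trans_le (h.trans h₃.le)) (lt_irrefl _)
  · exact absurd (h₄.trans_le (h.trans h₁.le)) (lt_irrefl _)

theorem Rect.disjoint_of_snd {Q R : Rect} (h : Q.d ≤ R.c ∨ R.d ≤ Q.c) :
    Disjoint Q.toSet R.toSet := by
  rw [Set.disjoint_left]
  rintro p ⟨-, ⟨h₁, h₂⟩⟩ ⟨-, ⟨h₃, h₄⟩⟩
  rcases h with h | h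
  · exact absurd (h₂.trans_le (h.trans h₃.le)) (lt_irrefl _)
  · exact absurd (h₄.trans_le (h.trans h₁.le)) (lt_irrefl _)

/-! ### Interfaces and local domains in normal and tangential coordinates -/

variable {T : CoarseGrid}

/-- The grid lines that cut the flux direction. -/
def CoarseGrid.normalLines (T : CoarseGrid) : Direction → ℤ → ℝ
  | .horizontal => T.x
  | .vertical => T.y

/-- The grid lines parallel to the flux direction. -/
def CoarseGrid.tangentLines (T : CoarseGrid) : Direction → ℤ → ℝ
  | .horizontal => T.y
  | .vertical => T.x

/-- The indices of a cell along the flux direction and perpendicular to it. -/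
def Direction.index : Direction → ℤ × ℤ → ℤ × ℤ
  | .horizontal, c => c
  | .vertical, c => c.swap

theorem CoarseGrid.strictMono_normalLines (D : Direction) : StrictMono (T.normalLines D) := by
  cases D
  exacts [T.x_strictMono, T.y_strictMono]

theorem CoarseGrid.strictMono_tangentLines (D : Direction) : StrictMono (T.tangentLines D) := by
  cases D
  exacts [T.y_strictMono, T.x_strictMono]

namespace CoarseGrid.Interface

variable (E F : T.Interface)

theorem level_eq : E.level = T.normalLines E.dir ((E.dir.index E.cell).1 + 1) := by
  obtain ⟨D, c, h, -, -⟩ := E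
  cases D <;> rfl

theorem lo_eq : E.lo = halfLo (T.tangentLines E.dir) (E.dir.index E.cell).2 E.half := by
  obtain ⟨D, c, h, -, -⟩ := E
  cases D <;> cases h <;> rfl

theorem hi_eq : E.hi = halfHi (T.tangentLines E.dir) (E.dir.index E.cell).2 E.half := by
  obtain ⟨D, c, h, -, -⟩ := E
  cases D <;> cases h <;> rfl

theorem rect_domain : E.dir.rect E.domain =
    ⟨mid (T.normalLines E.dir) (E.dir.index E.cell).1,
      mid (T.normalLines E.dir) ((E.dir.index E.cell).1 + 1), E.lo, E.hi⟩ := by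
  obtain ⟨D, c, h, -, -⟩ := E
  cases D <;> rfl

/-- Seen along the other direction, the two extents change roles: half a cell across, center to
center along. -/
theorem rect_domain_of_ne {D : Direction} (hD : F.dir ≠ D) : D.rect F.domain =
    ⟨halfLo (T.normalLines D) (D.index F.cell).1 F.half,
      halfHi (T.normalLines D) (D.index F.cell).1 F.half,
      mid (T.tangentLines D) (D.index F.cell).2,
      mid (T.tangentLines D) ((D.index F.cell).2 + 1)⟩ := by
  obtain ⟨D', c, h, _, _⟩ := F
  cases D <;> cases D' <;> first | exact absurd rfl hD | (cases h <;> rfl)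

theorem rect_domain_lo : (E.dir.rect E.domain).c = E.lo := by rw [rect_domain]

theorem rect_domain_hi : (E.dir.rect E.domain).d = E.hi := by rw [rect_domain]

theorem rect_domain_lt_level : (E.dir.rect E.domain).a < E.level := by
  rw [rect_domain, level_eq]
  exact mid_lt (strictMono_normalLines _) _

theorem level_lt_rect_domain : E.level < (E.dir.rect E.domain).b := by
  rw [rect_domain, level_eq]
  exact lt_mid (strictMono_normalLines _) _

theorem lo_lt_hi : E.lo < E.hi := by
  rw [lo_eq, hi_eq]
  exact halfLo_lt_halfHi (strictMono_tangentLines _) _ _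

/-- The part of the local domain on the left of the interface, or below it. -/
noncomputable def lowerPart : Rect := ⟨(E.dir.rect E.domain).a, E.level, E.lo, E.hi⟩

variable {E F}

/-- The local domain of another interface misses the part of the local domain of `E` on the left of
`E`, or it belongs to an interface of the other direction and has the same extent across `E`. -/
theorem disjoint_or_lowerPart_subset (hne : F ≠ E) :
    Disjoint (E.dir.rect F.domain).toSet E.lowerPart.toSet ∨
      F.dir ≠ E.dir ∧ (E.dir.rect F.domain).a = E.lowerPart.a ∧
        (E.dir.rect F.domain).b = E.lowerPart.b ∧ (E.dir.rect F.domain).c ≤ E.lo ∧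
        E.hi ≤ (E.dir.rect F.domain).d := by
  have hN := T.strictMono_normalLines E.dir
  have hT := T.strictMono_tangentLines E.dir
  set i := (E.dir.index E.cell).1 with hi
  set j := (E.dir.index E.cell).2 with hj
  -- From the cell center to the interface: across `E`, this is the `second` half of the cell,
  -- whatever `E.half` is.
  have hpart : E.lowerPart = ⟨halfLo (T.normalLines E.dir) i .second,
      halfHi (T.normalLines E.dir) i .second, halfLo (T.tangentLines E.dir) j E.half,
      halfHi (T.tangentLines E.dir) j E.half⟩ := by
    rw [lowerPart, rect_domain, level_eq, lo_eq, hi_eq]; rfl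
  by_cases hdir : F.dir = E.dir
  · left
    have hF := F.rect_domain
    rw [lo_eq, hi_eq, hdir] at hF
    by_cases hh : (E.dir.index F.cell).2 = j ∧ F.half = E.half
    · have hi' : (E.dir.index F.cell).1 ≠ i := by
        intro hi'
        refine hne ?_
        have hc : F.cell = E.cell := by
          have : E.dir.index F.cell = E.dir.index E.cell := Prod.ext hi' hh.1
          generalize E.dir = D at this
          cases D
          exacts [this, Prod.swap_injective this]
        obtain ⟨_, _, _, _, _⟩ := E
        obtain ⟨_, _, _, _, _⟩ := F
        simp_all
      rw [hF, hpart]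
      refine Rect.disjoint_of_fst ?_
      simp only [halfLo, halfHi]
      -- Strict inequality in `ℤ` is by definition `≤` after adding `1`, hence `h` serves directly
      -- as a bound on shifted indices.
      rcases lt_or_gt_of_ne hi' with h | h
      · exact .inl (mid_le_mid hN h)
      · exact .inr ((hN.monotone h).trans (lt_mid hN _).le)
    · rw [hF, hpart]
      exact Rect.disjoint_of_snd (halves_disjoint hT hh)
  · have hF := F.rect_domain_of_ne hdir
    set i' := (E.dir.index F.cell).1
    set j' := (E.dir.index F.cell).2
    rw [hF, hpart]
    -- A perpendicular domain overlaps across `E` only if it comes from the same column of cells, in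
    -- the direction of the flux, and from the same half.
    by_cases hh : i' = i ∧ F.half = .second
    · rcases half_subset_or_disjoint hT j j' E.half with h | h | h
      · refine .inr ⟨hdir, ?_, ?_, ?_, ?_⟩
        · rw [hh.1, hh.2]
        · rw [hh.1, hh.2]
        · rw [lo_eq]; exact h.1
        · rw [hi_eq]; exact h.2
      · exact .inl (Rect.disjoint_of_snd (.inr h))
      · exact .inl (Rect.disjoint_of_snd (.inl h))
    · exact .inl (Rect.disjoint_of_fst (halves_disjoint hN hh))

end CoarseGrid.Interface

/-! ### The flux through an interface -/

theorem CoarseGrid.Interface.dot_normal (E : T.Interface) (u : ℝ × ℝ → ℝ × ℝ) (q : ℝ × ℝ) :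
    dot (u (E.dir.frame q)) E.normal = (E.dir.field u q).1 := by
  obtain ⟨D, c, h, -, -⟩ := E
  cases D <;> simp [dot, CoarseGrid.Interface.normal, Direction.field, Direction.frame]

theorem CoarseGrid.Interface.rect_strip (E : T.Interface) (r s : ℝ) :
    E.dir.rect (E.strip r s) = ⟨E.level + r, E.level + s, E.lo, E.hi⟩ := by
  obtain ⟨D, c, h, -, -⟩ := E
  cases D <;> rfl

theorem CoarseGrid.Interface.point_eq (E : T.Interface) (t : ℝ) :
    E.point t = E.dir.frame (E.level, t) := by
  obtain ⟨D, c, h, -, -⟩ := E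
  cases D <;> rfl

theorem CoarseGrid.Interface.setIntegral_strip (E : T.Interface) (u : ℝ × ℝ → ℝ × ℝ) (r s : ℝ) :
    ∫ p in (E.strip r s).toSet, dot (u p) E.normal =
      ∫ q in Rect.toSet ⟨E.level + r, E.level + s, E.lo, E.hi⟩, (E.dir.field u q).1 := by
  rw [← E.rect_strip, ← E.dir.setIntegral_frame]
  simp only [E.dot_normal]

/-- As soon as the strip fits into the local domain, its mean flux is exactly `1`, so both limits
are limits of eventually constant functions. -/
theorem CoarseGrid.Interface.hasFlux_of_isUnitFlow (E : T.Interface) {u : ℝ × ℝ → ℝ × ℝ}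
    (hu : MemLp u 2 volume) (h : IsUnitFlow (E.dir.rect E.domain) (E.dir.field u)) :
    HasFlux E u 1 := by
  have hlt := E.rect_domain_lt_level
  have hgt := E.level_lt_rect_domain
  have hstrip : ∀ r s, (E.dir.rect E.domain).a ≤ E.level + r → E.level + s ≤ (E.dir.rect E.domain).b →
      r ≤ s → ∫ p in (E.strip r s).toSet, dot (u p) E.normal = s - r := by
    intro r s hr hs hrs
    rw [E.setIntegral_strip]
    have := h.setIntegral_fst hr hs (by linarith)
    rw [E.rect_domain_lo, E.rect_domain_hi] at this
    rw [this]
    ring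
  refine ⟨.of_forall fun ε => integrableOn_dot (hu.restrict _) continuous_const, ?_, ?_⟩
  · refine tendsto_const_nhds.congr' ?_
    filter_upwards [Ioo_mem_nhdsGT (show 0 < E.level - (E.dir.rect E.domain).a by linarith)]
      with ε hε
    rw [hstrip _ _ (by linarith [hε.2]) (by linarith) (by linarith [hε.1]), zero_sub, neg_neg,
      inv_mul_cancel₀ hε.1.ne']
  · refine tendsto_const_nhds.congr' ?_
    filter_upwards [Ioo_mem_nhdsGT (show 0 < (E.dir.rect E.domain).b - E.level by linarith)]
      with ε hε
    rw [hstrip _ _ (by linarith) (by linarith [hε.2]) hε.1.le, sub_zero, inv_mul_cancel₀ hε.1.ne']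

theorem CoarseGrid.Interface.intervalIntegral_eq_one (E : T.Interface) {u : ℝ × ℝ → ℝ × ℝ}
    (h : IsUnitFlow (E.dir.rect E.domain) (E.dir.field u)) {g : ℝ × ℝ → ℝ}
    (hg : HasClassicalNormal E u g) : ∫ t in E.lo..E.hi, g (E.point t) = 1 := by
  have hmp := E.dir.measurePreserving_frame.restrict_preimage E.domain.measurableSet
  rw [E.dir.preimage_frame] at hmp
  have hint := hg.integrable
  simp only [E.point_eq] at hint ⊢
  have key := h.intervalIntegral_eq_one E.rect_domain_lt_level E.level_lt_rect_domain.le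
    (g := g ∘ E.dir.frame)
  rw [E.rect_domain_lo, E.rect_domain_hi] at key
  refine key E.lo_lt_hi.le ?_ (fun y hy => ?_) hint
  · filter_upwards [hmp.quasiMeasurePreserving.ae_eq_comp hg.ae_eq] with q hq
    rw [hq, Function.comp_apply, E.dot_normal]
  · have := hg.continuousAt y hy
    rw [E.point_eq] at this
    exact ContinuousAt.comp this E.dir.continuous_frame.continuousAt

/-! ### Linear independence -/

/-- Pairing with `V` over `Q` is a linear functional that is unchanged on null sets; applied to a
vanishing combination it isolates the coefficient of `ψ i`. -/
theorem linearIndependent_toLp_of_biorthogonal {ι : Type*} {ψ : ι → ℝ × ℝ → ℝ × ℝ}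
    (hL : ∀ i, MemLp (ψ i) 2 volume)
    (h : ∀ i, ∃ (Q : Rect) (V : ℝ × ℝ → ℝ × ℝ), Continuous V ∧
      (∀ j ≠ i, ∫ p in Q.toSet, dot (ψ j p) (V p) = 0) ∧
      ∫ p in Q.toSet, dot (ψ i p) (V p) ≠ 0) :
    LinearIndependent ℝ fun i => (hL i).toLp (ψ i) := by
  rw [linearIndependent_iff']
  intro s c hsum i hi
  obtain ⟨Q, V, hV, hj, hi0⟩ := h i
  have hzero : ∀ᵐ p, ∑ j ∈ s, c j • ψ j p = 0 := by
    have h₁ : ∀ᵐ p, ∀ j ∈ s, (c j • (hL j).toLp (ψ j) : Lp (ℝ × ℝ) 2 volume) p = c j • ψ j p := by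
      refine (Finset.eventually_all s).2 fun j _ => ?_
      filter_upwards [Lp.coeFn_smul (c j) ((hL j).toLp (ψ j)), (hL j).coeFn_toLp] with p h h'
      rw [h, Pi.smul_apply, h']
    have h₂ := Lp.coeFn_finsetSum s fun j => c j • (hL j).toLp (ψ j)
    have h₃ := Lp.coeFn_zero (ℝ × ℝ) 2 (volume : Measure (ℝ × ℝ))
    rw [hsum] at h₂
    filter_upwards [h₁, h₂, h₃] with p hp₁ hp₂ hp₃
    rw [← Finset.sum_congr rfl hp₁, ← Finset.sum_apply, ← hp₂, hp₃, Pi.zero_apply]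
  have hint : ∀ j ∈ s, IntegrableOn (fun p => c j * dot (ψ j p) (V p)) Q.toSet := fun j _ =>
    (integrableOn_dot ((hL j).restrict _) hV).const_mul _
  have htot : ∑ j ∈ s, c j * ∫ p in Q.toSet, dot (ψ j p) (V p) = 0 := by
    simp only [← integral_const_mul]
    rw [← integral_finsetSum s hint]
    refine integral_eq_zero_of_ae (ae_restrict_of_ae ?_)
    filter_upwards [hzero] with p hp
    have hp₁ := congrArg Prod.fst hp
    have hp₂ := congrArg Prod.snd hp
    simp only [Prod.fst_sum, Prod.snd_sum, Prod.smul_fst, Prod.smul_snd, smul_eq_mul,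
      Prod.fst_zero, Prod.snd_zero] at hp₁ hp₂
    calc ∑ j ∈ s, c j * dot (ψ j p) (V p)
        = (∑ j ∈ s, c j * (ψ j p).1) * (V p).1 + (∑ j ∈ s, c j * (ψ j p).2) * (V p).2 := by
          rw [Finset.sum_mul, Finset.sum_mul, ← Finset.sum_add_distrib]
          exact Finset.sum_congr rfl fun j _ => by rw [dot]; ring
      _ = 0 := by rw [hp₁, hp₂, zero_mul, zero_mul, add_zero]
  rw [Finset.sum_eq_single_of_mem i hi fun j _ hji => by rw [hj j hji, mul_zero]] at htot
  exact (mul_eq_zero.1 htot).resolve_right hi0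

/-- Either the field vanishes on the lower part, or `F` is perpendicular to `E`. In the latter case
the support of `η` allows the integral to be extended to the whole domain of `F`, where the test
function vanishes on the inflow and outflow sides. -/
theorem CoarseGrid.Interface.setIntegral_lowerPart_eq_zero {E F : T.Interface} (hne : F ≠ E)
    {u : ℝ × ℝ → ℝ × ℝ} (hsupp : ∀ p ∉ F.domain.toSet, u p = 0)
    (hu : IsUnitFlow (F.dir.rect F.domain) (F.dir.field u)) {θ η : ℝ → ℝ}
    (hθ : ContDiff ℝ ∞ θ) (hη : ContDiff ℝ ∞ η) (hηs : tsupport η ⊆ Set.Ioo E.lo E.hi) :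
    ∫ q in E.lowerPart.toSet, dot (E.dir.field u q) (tensorGrad θ η q) = 0 := by
  rcases disjoint_or_lowerPart_subset hne with hdisj | ⟨hdir, ha, hb, hc, hd⟩
  · refine setIntegral_eq_zero_of_forall_eq_zero fun q hq => ?_
    have hq' : E.dir.frame q ∉ F.domain.toSet := fun hmem =>
      Set.disjoint_left.1 hdisj (by simpa using (E.dir.frame_mem_iff _ _).2 hmem) hq
    have h0 : E.dir.frame 0 = 0 := by cases E.dir <;> rfl
    simp [Direction.field, hsupp _ hq', h0, dot]
  · have hout : ∀ y ∉ Set.Ioo E.lo E.hi, η y = 0 ∧ deriv η y = 0 := fun y hy =>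
      ⟨image_eq_zero_of_notMem_tsupport fun hy' => hy (hηs hy'),
        Function.notMem_support.1 fun hy' => hy (hηs (support_deriv_subset hy'))⟩
    have hext : ∫ q in E.lowerPart.toSet, dot (E.dir.field u q) (tensorGrad θ η q) =
        ∫ q in (E.dir.rect F.domain).toSet, dot (E.dir.field u q) (tensorGrad θ η q) := by
      refine (setIntegral_eq_of_subset_of_forall_sdiff_eq_zero (Rect.measurableSet _)
        (Rect.toSet_subset ha.le hb.ge hc hd) ?_).symm
      rintro q ⟨⟨hq₁, -⟩, hq⟩
      rw [ha, hb] at hq₁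
      obtain ⟨h₁, h₂⟩ := hout q.2 fun hq₂ => hq ⟨hq₁, hq₂⟩
      simp [tensorGrad, dot, h₁, h₂]
    have hη0 : η (F.dir.rect F.domain).a = 0 ∧ η (F.dir.rect F.domain).b = 0 := by
      have hab : (F.dir.rect F.domain).a = (E.dir.rect F.domain).c ∧
          (F.dir.rect F.domain).b = (E.dir.rect F.domain).d := by
        generalize E.dir = D at hdir ⊢
        generalize F.domain = S
        revert hdir
        generalize F.dir = D'
        cases D <;> cases D' <;> simp [Direction.rect]
      rw [hab.1, hab.2]
      exact ⟨(hout _ fun h => absurd h.1 hc.not_gt).1, (hout _ fun h => absurd h.2 hd.not_gt).1⟩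
    rw [hext, E.dir.setIntegral_dot_frame]
    -- The flux direction of `F` is tangential to `E`, so `η` now plays the part of the factor that
    -- vanishes at both ends.
    have h := hu.noflow η θ hη hθ hη0.1 hη0.2
    rw [F.dir.setIntegral_dot_frame] at h
    rw [← h]
    have hfr : ∀ p, E.dir.frame (tensorGrad θ η (E.dir.frame p)) =
        F.dir.frame (tensorGrad η θ (F.dir.frame p)) := by
      intro p
      revert hdir
      generalize E.dir = D
      generalize F.dir = D'
      cases D <;> cases D' <;> simp [Direction.frame, tensorGrad, mul_comm]
    simp only [hfr]

end MsFV

/-! ### Assembly of the flux and independence statements -/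

theorem proposition1 (T : MsFV.CoarseGrid)
    (k : ℝ × ℝ → (ℝ × ℝ →ₗ[ℝ] ℝ × ℝ)) (v : ℝ × ℝ → ℝ × ℝ)
    (hv : ∀ E : T.Interface, E.domain.sideFlux v E.dir.inflow ≠ 0 ∧
      E.domain.sideFlux v E.dir.outflow ≠ 0)
    (φ : T.Interface → ℝ × ℝ → ℝ) (G : T.Interface → ℝ × ℝ → ℝ × ℝ)
    (hφ : ∀ E : T.Interface, MsFV.IsBasisSolution k v E (φ E) (G E)) :
    (∀ E : T.Interface,
      MsFV.HasFlux E (MsFV.velocityBasis k (G E) E) 1 ∧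
      ∀ g : ℝ × ℝ → ℝ, MsFV.HasClassicalNormal E (MsFV.velocityBasis k (G E) E) g →
        ∫ t in E.lo..E.hi, g (E.point t) = 1) ∧
    ∃ hL : ∀ E : T.Interface,
        MeasureTheory.MemLp (MsFV.velocityBasis k (G E) E) 2 MeasureTheory.volume,
      LinearIndependent ℝ (fun E => (hL E).toLp (MsFV.velocityBasis k (G E) E)) ∧
      ∃ b : Module.Basis T.Interface ℝ
          (MsFV.velocitySpace fun E => (hL E).toLp (MsFV.velocityBasis k (G E) E)),
        ∀ E, (b E : MeasureTheory.Lp (ℝ × ℝ) 2 MeasureTheory.volume) =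
          (hL E).toLp (MsFV.velocityBasis k (G E) E) := by
  have hu : ∀ E : T.Interface, MsFV.IsUnitFlow (E.dir.rect E.domain)
      (E.dir.field (MsFV.velocityBasis k (G E) E)) := fun E =>
    (hφ E).isUnitFlow (hv E).1 (hv E).2
  have hL : ∀ E : T.Interface, MemLp (MsFV.velocityBasis k (G E) E) 2 volume := fun E =>
    (hφ E).memLp_indicator
  have hli : LinearIndependent ℝ (fun E => (hL E).toLp (MsFV.velocityBasis k (G E) E)) := by
    refine MsFV.linearIndependent_toLp_of_biorthogonal hL fun E => ?_
    obtain ⟨θ, η, hθ, hη, hηs, hne⟩ :=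
      (hu E).exists_integral_ne_zero E.rect_domain_lt_level E.level_lt_rect_domain.le
    rw [E.rect_domain_lo, E.rect_domain_hi] at hηs hne
    -- `lowerPart` lives in the coordinates of `E.dir`; the functional is carried back to the plane
    -- so that it can be applied to all basis functions alike.
    have hQ : ∀ w : ℝ × ℝ → ℝ × ℝ,
        ∫ p in (E.dir.rect E.lowerPart).toSet,
          MsFV.dot (w p) (E.dir.frame (MsFV.tensorGrad θ η (E.dir.frame p))) =
        ∫ q in E.lowerPart.toSet, MsFV.dot (E.dir.field w q) (MsFV.tensorGrad θ η q) := fun w => by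
      rw [← E.dir.setIntegral_dot_frame, E.dir.rect_rect]
    refine ⟨E.dir.rect E.lowerPart, fun p => E.dir.frame (MsFV.tensorGrad θ η (E.dir.frame p)),
      E.dir.continuous_frame.comp ((MsFV.continuous_tensorGrad hθ hη).comp
        E.dir.continuous_frame), fun F hFE => ?_, ?_⟩
    · rw [hQ]
      exact MsFV.CoarseGrid.Interface.setIntegral_lowerPart_eq_zero hFE
        (fun p hp => Set.indicator_of_notMem hp _) (hu F) hθ hη hηs
    · rw [hQ]
      exact hne
  refine ⟨fun E => ⟨E.hasFlux_of_isUnitFlow (hL E) (hu E), fun g hg =>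
    E.intervalIntegral_eq_one (hu E) hg⟩, hL, hli, Module.Basis.span hli, fun E => ?_⟩
  exact congrArg Subtype.val (Module.Basis.span_apply hli E)
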